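/- Let $G=(V,E)$ be a finite simple graph with $V\neq\emptyset$ and without isolated vertices. Write $\mathbf x_v$ ($v\in V$), $\mathbf y_e$ ($e\in E$) for the standard basis of $\mathbb R^{|V|+|E|}$, and $H$ for the hyperplane of vectors with coordinate sum $1$. The cosmological polytope $\mathcal C_G\subseteq H$ is the convex hull of the points $\mathbf x_v+\mathbf x_w-\mathbf y_e$, $\mathbf x_v-\mathbf x_w+\mathbf y_e$, $-\mathbf x_v+\mathbf x_w+\mathbf y_e$ for $e=\{v,w\}\in E$. Its dual is $\mathcal C_G^\circ=\{x\in H: \langle x,y\rangle\ge 0 \text{ for all } y\in \operatorname{Cone}(\mathcal C_G)\}$, where $\operatorname{Cone}(\mathcal C_G)=\{\lambda y:\lambda\ge 0,\ y\in\mathcal C_G\}$. Boundary and interior of $\mathcal C_G^\circ$ are taken relative to its affine hull. A tube is a non-empty connected (not necessarily induced) subgraph $t=(V(t),E(t))$ of $G$; it is a singleton if it consists of one vertex. A tubing is a set $T$ of tubes such that any two $t_1,t_2\in T$ satisfy $V(t_1)\cap V(t_2)=\emptyset$, $E(t_1)\subseteq E(t_2)$ or $E(t_2)\subseteq E(t_1)$;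 it is maximal if it is maximal under inclusion, almost maximal if $|T|=|V|+|E|-1$, and an almost maximal tubing is uniquely completable if it is contained in exactly one maximal tubing. Let $\widetilde{\mathcal T}(G)$ be the set of uniquely completable almost maximal tubings. For a tube $t$ put $$h_t=\sum_{v\in V(t)}\mathbf x_v+\sum_{e\in E\setminus E(t)}|e\cap V(t)|\,\mathbf y_e,\qquad z_t=\frac{h_t}{|h_t|_1},$$ where $|\cdot|_1$ denotes the sum of the coordinates, and let $\sigma_T=\operatorname{conv}(z_t: t\in T)$. Then: 1. The sets $\sigma_T$, $T\in\widetilde{\mathcal T}(G)$, triangulate the boundary of $\mathcal C_G^\circ$: they are simplices of dimension $|V|+|E|-2$ with vertex sets $\{z_t: t\in T\}$, distinct for distinct $T$, and are exactly the maximal simplices of a geometric simplicial complex whose underlying space is the boundary of $\mathcal C_G^\circ$. 2. For every interior point $p$ of $\mathcal C_G^\circ$, the simplices $\operatorname{conv}(\{p\}\cup\{z_t: t\in T\})$, $T\in\widetilde{\mathcal T}(G)$, of dimension $|V|+|E|-1$, are the maximal simplices of a triangulation of $\mathcal C_G^\circ$. 3. If $G$ is connected, then a set of tubes belongs to $\widetilde{\mathcal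 T}(G)$ if and only if it is obtained from a maximal tubing by removing one tube that is a singleton or equal to $G$. -/

import Mathlib

noncomputable section

namespace Cosmological

variable {V : Type*}

/-- A tube of `G`: a non-empty connected, not necessarily induced, subgraph. (Connectedness of a
subgraph includes non-emptiness.) -/
def IsTube (G : SimpleGraph V) (t : G.Subgraph) : Prop := t.Connected

/-- A singleton tube: one vertex and no edges. -/
def IsSingleton (G : SimpleGraph V) (t : G.Subgraph) : Prop :=
  ∃ v : V, t = G.singletonSubgraph v

/-- A tubing: a set of tubes any two of which are disjoint or nested. -/
def IsTubing (G : SimpleGraph V) (T : Set G.Subgraph) : Prop :=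
  (∀ t ∈ T, IsTube G t) ∧
    ∀ t₁ ∈ T, ∀ t₂ ∈ T,
      Disjoint t₁.verts t₂.verts ∨ t₁.edgeSet ⊆ t₂.edgeSet ∨ t₂.edgeSet ⊆ t₁.edgeSet

/-- A maximal tubing: a tubing that is maximal with respect to inclusion. -/
def IsMaximalTubing (G : SimpleGraph V) (T : Set G.Subgraph) : Prop :=
  Maximal (IsTubing G) T

section Finite

variable [Fintype V] [DecidableEq V] (G : SimpleGraph V) [DecidableRel G.Adj]

/-- An almost maximal tubing: a tubing with `|V| + |E| - 1` tubes. -/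
def IsAlmostMaximal (T : Set G.Subgraph) : Prop :=
  IsTubing G T ∧ T.ncard + 1 = Fintype.card V + G.edgeFinset.card

/-- An almost maximal tubing contained in exactly one maximal tubing. -/
def IsUniquelyCompletable (T : Set G.Subgraph) : Prop :=
  IsAlmostMaximal G T ∧ ∃! M : Set G.Subgraph, IsMaximalTubing G M ∧ T ⊆ M

/-- The coordinate space of dimension `|V| + |E|`, with one coordinate for each vertex and
one for each edge. -/
abbrev Space : Type _ := V ⊕ G.edgeSet → ℝ

/-- The standard basis vector of a vertex. -/
def basisX (v : V) : Space G := Pi.single (Sum.inl v) 1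

/-- The standard basis vector of an edge. -/
def basisY (e : G.edgeSet) : Space G := Pi.single (Sum.inr e) 1

/-- The cosmological polytope. For an edge `e = {v, w}`, the ordered pairs `(v, w)` and `(w, v)`
together yield the three points `x_v + x_w - y_e`, `x_v - x_w + y_e` and `x_w - x_v + y_e`. -/
def cosmologicalPolytope : Set (Space G) :=
  convexHull ℝ {p | ∃ (v w : V) (h : G.Adj v w),
    p = basisX G v + basisX G w - basisY G ⟨s(v, w), h⟩ ∨
    p = basisX G v - basisX G w + basisY G ⟨s(v, w), h⟩}

/-- The affine hyperplane of vectors whose coordinates sum to one. -/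
def hyperplane : Set (Space G) := {x | ∑ i, x i = 1}

/-- The cone of nonnegative multiples of points of the set `P`. -/
def coneOver (P : Set (Space G)) : Set (Space G) :=
  {x | ∃ c : ℝ, 0 ≤ c ∧ ∃ y ∈ P, x = c • y}

/-- The dual cone of a set `C`. -/
def dualCone (C : Set (Space G)) : Set (Space G) := {x | ∀ y ∈ C, 0 ≤ x ⬝ᵥ y}

/-- The dual cosmological polytope: the slice of the dual cone of the cone over the cosmological
polytope by the hyperplane in which the cosmological polytope is full-dimensional. -/
def dualPolytope : Set (Space G) :=
  dualCone G (coneOver G (cosmologicalPolytope G)) ∩ hyperplane G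

open Classical in
/-- The vector `h_t = ∑_{v ∈ V(t)} x_v + ∑_{e ∈ E \ E(t)} |e ∩ V(t)| y_e` of a tube `t`. -/
def tubeNormal (t : G.Subgraph) : Space G :=
  Sum.elim
    (fun v => if v ∈ t.verts then 1 else 0)
    (fun e => if (e : Sym2 V) ∈ t.edgeSet then 0
      else ((((e : Sym2 V) : Set V) ∩ t.verts).ncard : ℝ))

/-- The point `z_t`: the vector `h_t` divided by the sum of its coordinates. -/
def tubePoint (t : G.Subgraph) : Space G := (∑ i, tubeNormal G t i)⁻¹ • tubeNormal G t

/-- The vertex set `{z_t | t ∈ T}` of the simplex of `T`. -/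
def simplexVertices (T : Set G.Subgraph) : Set (Space G) := tubePoint G '' T

end Finite

/-- The simplices with vertex sets in `S` are, without omission, the maximal simplices of a
geometric simplicial complex whose underlying space is `X`, and each of them has `n` vertices,
that is, dimension `n - 1`. -/
def IsTriangulation {W : Type*} [AddCommGroup W] [Module ℝ W] (n : ℕ) (S : Set (Set W))
    (X : Set W) : Prop :=
  ∃ K : Geometry.SimplicialComplex ℝ W,
    (fun s : Finset W => (s : Set W)) '' K.facets = S ∧
    (∀ s ∈ K.facets, s.card = n) ∧
    K.space = X

end Cosmological

end

/-!
In the coordinates `a_v = x_v` for vertices and `s_e = (x_v + x_w - x_e) / 2` for edges `e = {v, w}`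
(`filtrationMap`), the inequalities of the dual cone become `0 ≤ s_e ≤ a_v` for all `v ∈ e`. So the
points of the dual cone are the functions on vertices and edges whose superlevel sets are subgraphs
of `G` (`IsFiltration`), and `h_t` becomes the indicator function of the subgraph `t`.

The connected components of the superlevel sets of such a function form a laminar family of tubes,
that is, a tubing, and they express the function as a nonnegative combination of indicator
functions (`exists_combination`). This combination is the only one with support in a tubing
(`combination_injective`), since a tubing covering a connected subgraph has a single tube
containing that subgraph (`IsTubing.exists_ge_of_cover`). Hence the dual cone is the union of a
simplicial fan whose cones are spanned by the tubings. The uniqueness of the combinations is all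
that is needed to see that the corresponding simplices glue to a simplicial complex
(`UniqueReps.isTriangulation`).

A point lies in the boundary of the dual polytope if one of the inequalities is an equality, and
for a combination of the tubes of a tubing `T` this happens precisely if `T` misses a singleton or
a component of `G` (`combination_tight_iff`). Singletons and components belong to all maximal
tubings, so that removing one of them from a maximal tubing gives a uniquely completable tubing.
All uniquely completable tubings are of this form: for a maximal tubing, sending an edge to the
smallest tube containing it is a bijection from `E` to the tubes that are not singletons, so maximal
tubings have `|V| + |E|` tubes (`IsMaximalTubing.ncard_eq`), and a removed tube other than a singleton or a component can be
replaced by splitting the next larger tube along a different edge (`isSpecial_of_unique`). Thus the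
uniquely completable tubings are the maximal ones among those contributing to the boundary
(`maximal_boundaryTubings_iff`).

For an interior point `p`, the largest multiple of `p` that can be subtracted from a point within
the dual cone leaves a boundary point, and this decomposition is unique. So the boundary simplices
together with `p` have unique combinations as well, and the same criterion applies.
-/

namespace Cosmological

/-! ### Connected subgraphs -/

section Combinatorics

variable {V : Type*} {G : SimpleGraph V}

/-- A property that holds at one vertex of a connected subgraph and spreads along its edges holds
at all its vertices. -/
lemma connected_induction {t : G.Subgraph} (ht : t.Connected) {P : V → Prop} {x : V}
    (hx : x ∈ t.verts) (hP : P x) (hstep : ∀ a b, t.Adj a b → P a → P b) :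
    ∀ y ∈ t.verts, P y := by
  intro y hy
  obtain ⟨w⟩ := ht.preconnected ⟨x, hx⟩ ⟨y, hy⟩
  have key : ∀ (a b : t.verts), t.coe.Walk a b → P a → P b := by
    intro a b w
    induction w with
    | nil => exact id
    | cons h _ ih => exact fun hp => ih (hstep _ _ h hp)
  exact key _ _ w hP

/-- A connected subgraph that meets `s` and has all its edges in `s` lies in `s`. -/
lemma le_of_edgeSet_subset {t s : G.Subgraph} (ht : t.Connected) (h : t.edgeSet ⊆ s.edgeSet)
    {x : V} (hxt : x ∈ t.verts) (hxs : x ∈ s.verts) : t ≤ s := by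
  have hadj : ∀ a b, t.Adj a b → s.Adj a b := fun a b hab => h (show s(a, b) ∈ t.edgeSet from hab)
  exact ⟨connected_induction ht hxt hxs fun a b hab _ => (hadj a b hab).snd_mem, hadj⟩

lemma connected_sup_of_mem {t s : G.Subgraph} (ht : t.Connected) (hs : s.Connected)
    {x : V} (hxt : x ∈ t.verts) (hxs : x ∈ s.verts) : (t ⊔ s).Connected :=
  SimpleGraph.Subgraph.connected_sup ht.preconnected hs.preconnected ⟨x, hxt, hxs⟩

/-- A connected subgraph other than a single vertex has an edge at each of its vertices. -/
lemma exists_adj_of_not_isSingleton {t : G.Subgraph} (ht : t.Connected) (hs : ¬ IsSingleton G t)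
    {v : V} (hv : v ∈ t.verts) : ∃ w, t.Adj v w := by
  by_contra! hno
  refine hs ⟨v, ?_⟩
  rw [SimpleGraph.eq_singletonSubgraph_iff_verts_eq]
  refine Set.eq_singleton_iff_unique_mem.2 ⟨hv, ?_⟩
  refine connected_induction ht hv rfl ?_
  rintro a b hab rfl
  exact absurd hab (hno b)

lemma isSingleton_iff {t : G.Subgraph} (ht : t.Connected) :
    IsSingleton G t ↔ t.edgeSet = ∅ := by
  constructor
  · rintro ⟨v, rfl⟩
    exact SimpleGraph.edgeSet_singletonSubgraph v
  · intro h
    by_contra hs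
    obtain ⟨v, hv⟩ := ht.nonempty
    obtain ⟨w, hw⟩ := exists_adj_of_not_isSingleton ht hs hv
    have : s(v, w) ∈ t.edgeSet := hw
    simp [h] at this

lemma adj_of_mem_edgeSet {t : G.Subgraph} {v w : V} (h : s(v, w) ∈ t.edgeSet) : t.Adj v w := h

lemma mem_verts_of_mem_edgeSet {t : G.Subgraph} {e : Sym2 V} (h : e ∈ t.edgeSet) {v : V}
    (hv : v ∈ e) : v ∈ t.verts := by
  induction e with
  | h a b =>
    rcases Sym2.mem_iff.1 hv with rfl | rfl
    · exact (adj_of_mem_edgeSet h).fst_mem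
    · exact (adj_of_mem_edgeSet h).snd_mem

lemma edgeSet_subset_of_le {t s : G.Subgraph} (h : t ≤ s) : t.edgeSet ⊆ s.edgeSet :=
  SimpleGraph.Subgraph.edgeSet_mono h

/-- Every connected subgraph of `S` lies in a connected component of `S`: a connected subgraph
`C` of `S` such that all connected subgraphs of `S` lie in `C` or are disjoint from it. -/
lemma exists_component [Finite V] {S t : G.Subgraph} (ht : t.Connected) (htS : t ≤ S) :
    ∃ C : G.Subgraph, C.Connected ∧ t ≤ C ∧ C ≤ S ∧
      ∀ s : G.Subgraph, s.Connected → s ≤ S → s ≤ C ∨ Disjoint s.verts C.verts := by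
  obtain ⟨C, htC, hC⟩ := (Set.toFinite {s : G.Subgraph | s.Connected ∧ s ≤ S}).exists_le_maximal
    (⟨ht, htS⟩ : t ∈ {s : G.Subgraph | s.Connected ∧ s ≤ S})
  refine ⟨C, hC.prop.1, htC, hC.prop.2, fun s hs hsS => ?_⟩
  refine or_iff_not_imp_right.2 fun hd => ?_
  obtain ⟨x, hxs, hxC⟩ := Set.not_disjoint_iff.1 hd
  exact le_sup_left.trans (hC.le_of_ge
    ⟨connected_sup_of_mem hs hC.prop.1 hxs hxC, sup_le hsS hC.prop.2⟩ le_sup_right)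

/-! ### Tubings -/

/-- Tubings are laminar families: since a tube other than a singleton is determined by its edges,
the condition on edge sets amounts to nestedness of subgraphs. -/
lemma isTubing_iff {T : Set G.Subgraph} : IsTubing G T ↔ (∀ t ∈ T, t.Connected) ∧
    ∀ t ∈ T, ∀ s ∈ T, Disjoint t.verts s.verts ∨ t ≤ s ∨ s ≤ t := by
  refine and_congr_right fun hconn => ?_
  refine forall₂_congr fun t ht => forall₂_congr fun s hs => ?_
  constructor
  · intro h
    refine or_iff_not_imp_left.2 fun hd => ?_
    obtain ⟨x, hxt, hxs⟩ := Set.not_disjoint_iff.1 hd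
    rcases h.resolve_left hd with h | h
    · exact Or.inl (le_of_edgeSet_subset (hconn t ht) h hxt hxs)
    · exact Or.inr (le_of_edgeSet_subset (hconn s hs) h hxs hxt)
  · rintro (h | h | h)
    · exact Or.inl h
    · exact Or.inr (Or.inl (edgeSet_subset_of_le h))
    · exact Or.inr (Or.inr (edgeSet_subset_of_le h))

lemma IsTubing.connected {T : Set G.Subgraph} (hT : IsTubing G T) {t : G.Subgraph} (ht : t ∈ T) :
    t.Connected := hT.1 t ht

lemma IsTubing.le_total_of_mem {T : Set G.Subgraph} (hT : IsTubing G T) {t s : G.Subgraph}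
    (ht : t ∈ T) (hs : s ∈ T) {x : V} (hxt : x ∈ t.verts) (hxs : x ∈ s.verts) :
    t ≤ s ∨ s ≤ t :=
  ((isTubing_iff.1 hT).2 t ht s hs).resolve_left
    fun hd => Set.disjoint_left.1 hd hxt hxs

lemma IsTubing.mono {T U : Set G.Subgraph} (hT : IsTubing G T) (h : U ⊆ T) : IsTubing G U :=
  ⟨fun t ht => hT.1 t (h ht), fun t ht s hs => hT.2 t (h ht) s (h hs)⟩

lemma IsTubing.insert {T : Set G.Subgraph} (hT : IsTubing G T) {u : G.Subgraph}
    (hu : u.Connected) (h : ∀ s ∈ T, Disjoint u.verts s.verts ∨ u ≤ s ∨ s ≤ u) :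
    IsTubing G (insert u T) := by
  rw [isTubing_iff] at hT ⊢
  refine ⟨?_, ?_⟩
  · rintro t (rfl | ht)
    · exact hu
    · exact hT.1 t ht
  · rintro t (rfl | ht) s (rfl | hs)
    · exact Or.inr (Or.inl le_rfl)
    · exact h s hs
    · rcases h t ht with h | h | h
      · exact Or.inl h.symm
      · exact Or.inr (Or.inr h)
      · exact Or.inr (Or.inl h)
    · exact hT.2 t ht s hs

lemma IsTubing.exists_maximal [Finite V] {T : Set G.Subgraph} (hT : IsTubing G T) :
    ∃ M, IsMaximalTubing G M ∧ T ⊆ M := by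
  obtain ⟨M, hTM, hM⟩ := (Set.toFinite {T | IsTubing G T}).exists_le_maximal hT
  exact ⟨M, hM, hTM⟩

lemma IsMaximalTubing.mem {M : Set G.Subgraph} (hM : IsMaximalTubing G M) {u : G.Subgraph}
    (hu : u.Connected) (h : ∀ s ∈ M, Disjoint u.verts s.verts ∨ u ≤ s ∨ s ≤ u) : u ∈ M :=
  hM.le_of_ge (hM.prop.insert hu h) (Set.subset_insert u M) (Set.mem_insert u M)

/-- A tubing covering a connected subgraph has a single tube containing that subgraph. Indeed a
maximal tube at one vertex of the subgraph cannot be left along an edge of the subgraph. -/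
lemma IsTubing.exists_ge_of_cover [Finite V] {T : Set G.Subgraph} (hT : IsTubing G T)
    {t : G.Subgraph} (ht : t.Connected) (hv : ∀ x ∈ t.verts, ∃ s ∈ T, x ∈ s.verts)
    (he : ∀ a b, t.Adj a b → ∃ s ∈ T, s.Adj a b) : ∃ u ∈ T, t ≤ u := by
  obtain ⟨x, hx⟩ := ht.nonempty
  obtain ⟨s, hsT, hxs⟩ := hv x hx
  obtain ⟨u, -, hu⟩ := (Set.toFinite {s | s ∈ T ∧ x ∈ s.verts}).exists_le_maximal
    (⟨hsT, hxs⟩ : s ∈ {s | s ∈ T ∧ x ∈ s.verts})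
  have step : ∀ a b, t.Adj a b → a ∈ u.verts → u.Adj a b := by
    intro a b hab ha
    obtain ⟨w, hwT, hw⟩ := he a b hab
    rcases hT.le_total_of_mem hwT hu.prop.1 hw.fst_mem ha with h | h
    · exact h.2 hw
    · exact (hu.le_of_ge ⟨hwT, h.1 hu.prop.2⟩ h).2 hw
  have hverts := connected_induction ht hx hu.prop.2
    (P := fun y => y ∈ u.verts) fun a b hab ha => (step a b hab ha).snd_mem
  exact ⟨u, hu.prop.1, hverts, fun a b hab => step a b hab (hverts a hab.fst_mem)⟩

/-- Variant of `IsTubing.exists_ge_of_cover` in which only edges have to be covered. -/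
lemma IsTubing.exists_ge_of_cover_edges [Finite V] {T : Set G.Subgraph} (hT : IsTubing G T)
    {t : G.Subgraph} (ht : t.Connected) (hs : ¬ IsSingleton G t)
    (he : ∀ a b, t.Adj a b → ∃ s ∈ T, s.Adj a b) : ∃ u ∈ T, t ≤ u := by
  refine hT.exists_ge_of_cover ht (fun x hx => ?_) he
  obtain ⟨y, hy⟩ := exists_adj_of_not_isSingleton ht hs hx
  obtain ⟨s, hsT, hs⟩ := he x y hy
  exact ⟨s, hsT, hs.fst_mem⟩

/-! ### Singletons and components belong to all maximal tubings -/

/-- The tubes that are compatible with all tubes: the singletons, and the connected components of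
the graph, which are described as the maximal tubes. -/
def IsSpecial (G : SimpleGraph V) (t : G.Subgraph) : Prop :=
  IsSingleton G t ∨ Maximal (IsTube G) t

lemma IsSpecial.connected {t : G.Subgraph} (h : IsSpecial G t) : t.Connected := by
  rcases h with ⟨v, rfl⟩ | h
  · exact SimpleGraph.Subgraph.singletonSubgraph_connected
  · exact h.prop

lemma IsSpecial.compatible {t : G.Subgraph} (h : IsSpecial G t) {s : G.Subgraph}
    (hs : s.Connected) : Disjoint t.verts s.verts ∨ t ≤ s ∨ s ≤ t := by
  refine or_iff_not_imp_left.2 fun hd => ?_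
  obtain ⟨x, hxt, hxs⟩ := Set.not_disjoint_iff.1 hd
  rcases h with ⟨v, rfl⟩ | h
  · left
    rw [SimpleGraph.singletonSubgraph_le_iff]
    rw [show x = v from hxt] at hxs
    exact hxs
  · right
    exact le_sup_right.trans (h.le_of_ge (connected_sup_of_mem h.prop hs hxt hxs) le_sup_left)

lemma IsSpecial.mem {t : G.Subgraph} (h : IsSpecial G t) {M : Set G.Subgraph}
    (hM : IsMaximalTubing G M) : t ∈ M :=
  hM.mem h.connected fun _ hs => h.compatible (hM.prop.connected hs)

lemma exists_maximal_tube_ge [Finite V] {t : G.Subgraph} (ht : t.Connected) :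
    ∃ C, Maximal (IsTube G) C ∧ t ≤ C := by
  obtain ⟨C, htC, hC⟩ := (Set.toFinite {s | IsTube G s}).exists_le_maximal ht
  exact ⟨C, hC, htC⟩

lemma not_isSingleton_of_maximal {t : G.Subgraph} (hG : ∀ v : V, ∃ w : V, G.Adj v w)
    (h : Maximal (IsTube G) t) : ¬ IsSingleton G t := by
  rintro ⟨v, rfl⟩
  obtain ⟨w, hw⟩ := hG v
  have h1 := h.le_of_ge (SimpleGraph.Subgraph.subgraphOfAdj_connected hw)
    SimpleGraph.singletonSubgraph_fst_le_subgraphOfAdj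
  exact h1.2 (SimpleGraph.subgraphOfAdj_adj_self hw)

lemma maximal_tube_iff_eq_top (hG : G.Connected) {t : G.Subgraph} :
    Maximal (IsTube G) t ↔ t = ⊤ := by
  have htop : IsTube G (⊤ : G.Subgraph) := by
    rw [IsTube, SimpleGraph.Subgraph.connected_iff']
    exact SimpleGraph.Subgraph.topIso.connected_iff.2 hG
  constructor
  · exact fun h => top_le_iff.1 (h.le_of_ge htop le_top)
  · rintro rfl
    exact ⟨htop, fun _ _ _ => le_top⟩

/-! ### The size of maximal tubings -/

/-- Every edge `e` has a smallest tube of a maximal tubing `M` containing it. This sets up a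
bijection between the edges of the graph and the tubes of `M` that are not singletons. -/
lemma IsMaximalTubing.exists_isLeast [Finite V] {M : Set G.Subgraph} (hM : IsMaximalTubing G M)
    {e : Sym2 V} (he : e ∈ G.edgeSet) : ∃ t, IsLeast {s ∈ M | e ∈ s.edgeSet} t := by
  induction e with
  | h v w =>
  obtain ⟨C, hC, hle⟩ := exists_maximal_tube_ge
    (SimpleGraph.Subgraph.subgraphOfAdj_connected (G := G) (v := v) (w := w) he)
  have hCM : C ∈ {s ∈ M | s(v, w) ∈ s.edgeSet} :=
    ⟨IsSpecial.mem (Or.inr hC) hM, hle.2 (SimpleGraph.subgraphOfAdj_adj_self _)⟩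
  obtain ⟨t, -, ht⟩ := (Set.toFinite {s ∈ M | s(v, w) ∈ s.edgeSet}).exists_le_minimal hCM
  refine ⟨t, ht.prop, fun s hs => ?_⟩
  rcases hM.prop.le_total_of_mem ht.prop.1 hs.1 (adj_of_mem_edgeSet ht.prop.2).fst_mem
    (adj_of_mem_edgeSet hs.2).fst_mem with h | h
  · exact h
  · exact ht.le_of_le hs h

/-- In a tubing, every tube with an edge has an edge lying in no smaller tube. -/
lemma IsTubing.exists_edge_isLeast [Finite V] {T : Set G.Subgraph} (hT : IsTubing G T)
    {t : G.Subgraph} (ht : t ∈ T) (hs : ¬ IsSingleton G t) :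
    ∃ e ∈ G.edgeSet, IsLeast {s ∈ T | e ∈ s.edgeSet} t := by
  by_contra! hno
  obtain ⟨u, hu, htu⟩ := (hT.mono (Set.sep_subset T (fun s => s < t))).exists_ge_of_cover_edges
    (hT.connected ht) hs (by
      intro a b hab
      have h1 := hno s(a, b) hab.adj_sub
      by_contra! h2
      refine h1 ⟨⟨ht, hab⟩, fun s hs => ?_⟩
      rcases hT.le_total_of_mem ht hs.1 hab.fst_mem (adj_of_mem_edgeSet hs.2).fst_mem with h | h
      · exact h
      · by_contra hlt
        exact h2 s ⟨hs.1, lt_of_le_not_ge h hlt⟩ hs.2)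
  exact absurd htu hu.2.not_ge

/-- If a tube `t` of a tubing `T` and an edge `e` are such that no smaller tube of `T` contains
`e`, then a component of `t` minus the edge `e` may be added to `T`. -/
lemma IsTubing.exists_compatible_of_delete [Finite V] {T : Set G.Subgraph} (hT : IsTubing G T)
    {t : G.Subgraph} (hcomp : ∀ s ∈ T, Disjoint t.verts s.verts ∨ t ≤ s ∨ s < t)
    {e f : Sym2 V} (he : ∀ s ∈ T, s < t → e ∉ s.edgeSet)
    (hf : f ∈ t.edgeSet) (hne : f ≠ e) :
    ∃ u : G.Subgraph, u.Connected ∧ u ≤ t ∧ f ∈ u.edgeSet ∧ e ∉ u.edgeSet ∧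
      ∀ s ∈ T, Disjoint u.verts s.verts ∨ u ≤ s ∨ s ≤ u := by
  induction f with
  | h v w =>
  have hvw : t.Adj v w := hf
  have hle : G.subgraphOfAdj hvw.adj_sub ≤ t.deleteEdges {e} := by
    rw [SimpleGraph.subgraphOfAdj_le_iff, SimpleGraph.Subgraph.deleteEdges_adj]
    exact ⟨hvw, hne⟩
  obtain ⟨u, hu, hvu, hud, hall⟩ :=
    exists_component (SimpleGraph.Subgraph.subgraphOfAdj_connected hvw.adj_sub) hle
  have hut : u ≤ t := hud.trans (SimpleGraph.Subgraph.deleteEdges_le {e})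
  refine ⟨u, hu, hut, hvu.2 (SimpleGraph.subgraphOfAdj_adj_self _), ?_, ?_⟩
  · intro heu
    have := edgeSet_subset_of_le hud heu
    induction e with
    | h a b => simp [SimpleGraph.Subgraph.deleteEdges_adj] at this
  · intro s hs
    rcases hcomp s hs with h | h | h
    · exact Or.inl (h.mono_left hut.1)
    · exact Or.inr (Or.inl (hut.trans h))
    · have hsd : s ≤ t.deleteEdges {e} := by
        refine ⟨h.le.1, fun a b hab => ?_⟩
        rw [SimpleGraph.Subgraph.deleteEdges_adj]
        refine ⟨h.le.2 hab, ?_⟩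
        rintro rfl
        exact he s hs h hab
      rcases hall s (hT.connected hs) hsd with h | h
      · exact Or.inr (Or.inr h)
      · exact Or.inl h.symm

lemma IsTubing.disjoint_or_le_or_lt {T : Set G.Subgraph} (hT : IsTubing G T)
    {t s : G.Subgraph} (ht : t ∈ T) (hs : s ∈ T) :
    Disjoint t.verts s.verts ∨ t ≤ s ∨ s < t := by
  rcases (isTubing_iff.1 hT).2 t ht s hs with h | h | h
  · exact Or.inl h
  · exact Or.inr (Or.inl h)
  · rcases h.eq_or_lt with rfl | h
    · exact Or.inr (Or.inl le_rfl)
    · exact Or.inr (Or.inr h)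

/-- The edge assigned to a tube of a maximal tubing is unique: otherwise the tube could be split
along one of two such edges, and the part containing the other edge could be added. -/
lemma IsMaximalTubing.edge_unique [Finite V] {M : Set G.Subgraph} (hM : IsMaximalTubing G M)
    {t : G.Subgraph} {e f : Sym2 V} (he : IsLeast {s ∈ M | e ∈ s.edgeSet} t)
    (hf : IsLeast {s ∈ M | f ∈ s.edgeSet} t) : f = e := by
  by_contra hne
  obtain ⟨u, hu, hut, hfu, heu, hall⟩ := hM.prop.exists_compatible_of_delete
    (fun s hs => hM.prop.disjoint_or_le_or_lt he.1.1 hs)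
    (fun s hs hst hes => hst.not_ge (he.2 ⟨hs, hes⟩)) hf.1.2 hne
  exact heu (edgeSet_subset_of_le (hf.2 ⟨hM.mem hu hall, hfu⟩) he.1.2)

lemma IsMaximalTubing.ncard_eq [Fintype V] [DecidableRel G.Adj]
    {M : Set G.Subgraph} (hM : IsMaximalTubing G M) :
    M.ncard = Fintype.card V + G.edgeFinset.card := by
  classical
  have hsing : {t ∈ M | IsSingleton G t} = Set.range G.singletonSubgraph := by
    ext t
    constructor
    · rintro ⟨-, v, rfl⟩
      exact ⟨v, rfl⟩
    · rintro ⟨v, rfl⟩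
      exact ⟨IsSpecial.mem (Or.inl ⟨v, rfl⟩) hM, v, rfl⟩
  have h1 : {t ∈ M | IsSingleton G t}.ncard = Fintype.card V := by
    rw [hsing, Set.ncard_range_of_injective, Nat.card_eq_fintype_card]
    intro v w h
    have := congrArg SimpleGraph.Subgraph.verts h
    simpa using this
  have h2 : {t ∈ M | ¬ IsSingleton G t}.ncard = G.edgeFinset.card := by
    rw [← Set.ncard_coe_finset, SimpleGraph.coe_edgeFinset]
    symm
    choose! τ hτ using fun e (he : e ∈ G.edgeSet) => hM.exists_isLeast he
    refine Set.ncard_congr (fun e _ => τ e) ?_ ?_ ?_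
    · intro e he
      refine ⟨(hτ e he).1.1, fun hs => ?_⟩
      have := (hτ e he).1.2
      rw [(isSingleton_iff (hM.prop.connected (hτ e he).1.1)).1 hs] at this
      exact this
    · intro e f he hf hef
      have h := hτ f hf
      rw [← hef] at h
      exact hM.edge_unique h (hτ e he)
    · rintro t ⟨ht, hs⟩
      obtain ⟨e, he, hl⟩ := hM.prop.exists_edge_isLeast ht hs
      exact ⟨e, he, (hτ e he).unique hl⟩
  have h3 : M = {t ∈ M | IsSingleton G t} ∪ {t ∈ M | ¬ IsSingleton G t} := by
    ext t
    by_cases h : IsSingleton G t <;> simp [h]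
  rw [h3, Set.ncard_union_eq ?_ (Set.toFinite _) (Set.toFinite _), h1, h2]
  exact Set.disjoint_left.2 fun t h h' => h'.2 h.2

/-! ### Uniquely completable tubings -/

/-- If the tube `t` of a maximal tubing is neither a singleton nor a component, then after removal
of `t` the next larger tube can be split in another way. -/
lemma isSpecial_of_unique [Finite V] {M : Set G.Subgraph} (hM : IsMaximalTubing G M)
    {t : G.Subgraph} (ht : t ∈ M) (huniq : ∀ M', IsMaximalTubing G M' → M \ {t} ⊆ M' → M' = M) :
    IsSpecial G t := by
  by_contra hsp
  rw [IsSpecial, not_or] at hsp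
  obtain ⟨C, hC, htC⟩ := exists_maximal_tube_ge (hM.prop.connected ht)
  have hCt : C ≠ t := by
    rintro rfl
    exact hsp.2 hC
  have hCM : C ∈ {s ∈ M | t < s} :=
    ⟨IsSpecial.mem (Or.inr hC) hM, lt_of_le_of_ne htC hCt.symm⟩
  -- `p` is the tube of `M` next above `t`
  obtain ⟨p, -, hp⟩ := (Set.toFinite {s ∈ M | t < s}).exists_le_minimal hCM
  have hpM : p ∈ M := hp.prop.1
  have htp : t < p := hp.prop.2
  obtain ⟨e, -, he⟩ := hM.prop.exists_edge_isLeast ht hsp.1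
  have hps : ¬ IsSingleton G p := by
    intro hs
    have h1 := edgeSet_subset_of_le htp.le he.1.2
    rw [(isSingleton_iff (hM.prop.connected hpM)).1 hs] at h1
    exact h1
  obtain ⟨f, -, hf⟩ := hM.prop.exists_edge_isLeast hpM hps
  have hne : f ≠ e := by
    rintro rfl
    exact htp.not_ge (hf.2 ⟨ht, he.1.2⟩)
  have hT := hM.prop.mono (Set.sdiff_subset (s := M) (t := {t}))
  obtain ⟨u, hu, hup, hfu, heu, hall⟩ := hT.exists_compatible_of_delete
    (fun s hs => hM.prop.disjoint_or_le_or_lt hpM hs.1)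
    (fun s hs hsp hes => hsp.not_ge (hp.le_of_le
      ⟨hs.1, lt_of_le_of_ne (he.2 ⟨hs.1, hes⟩) (Ne.symm hs.2)⟩ hsp.le)) hf.1.2 hne
  obtain ⟨M', hM', hsub⟩ := (hT.insert hu hall).exists_maximal
  have hMM := huniq M' hM' ((Set.subset_insert _ _).trans hsub)
  have huM : u ∈ M := hMM ▸ hsub (Set.mem_insert _ _)
  exact heu (edgeSet_subset_of_le (hf.2 ⟨huM, hfu⟩) (edgeSet_subset_of_le htp.le he.1.2))

lemma isUniquelyCompletable_iff [Fintype V] [DecidableEq V] [DecidableRel G.Adj]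
    {T : Set G.Subgraph} : IsUniquelyCompletable G T ↔
    ∃ M, IsMaximalTubing G M ∧ ∃ t ∈ M, IsSpecial G t ∧ T = M \ {t} := by
  constructor
  · rintro ⟨⟨-, hcard⟩, M, ⟨hM, hTM⟩, huniq⟩
    have h1 : (M \ T).ncard = 1 := by
      have h2 := Set.ncard_sdiff_add_ncard_of_subset hTM
      have h3 := hM.ncard_eq
      omega
    obtain ⟨t, ht⟩ := Set.ncard_eq_one.1 h1
    have hT : T = M \ {t} := by
      rw [← ht, Set.sdiff_sdiff_cancel_left hTM]
    have htM : t ∈ M := by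
      have : t ∈ M \ T := ht ▸ Set.mem_singleton t
      exact this.1
    exact ⟨M, hM, t, htM, isSpecial_of_unique hM htM fun M' hM' hs => huniq M' ⟨hM', hT ▸ hs⟩, hT⟩
  · rintro ⟨M, hM, t, htM, hsp, rfl⟩
    refine ⟨⟨hM.prop.mono Set.sdiff_subset, ?_⟩, M, ⟨hM, Set.sdiff_subset⟩, ?_⟩
    · rw [Set.ncard_sdiff_singleton_add_one htM, hM.ncard_eq]
    · rintro M' ⟨hM', hsub⟩
      refine (hM.eq_of_subset hM'.prop fun s hs => ?_).symm
      by_cases h : s = t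
      · rw [h]
        exact hsp.mem hM'
      · exact hsub ⟨hs, h⟩

/-- The tubings that miss some tube belonging to all maximal tubings. Their simplices turn out to
be those lying in the boundary of the dual polytope. -/
def boundaryTubings (G : SimpleGraph V) : Set (Set G.Subgraph) :=
  {T | IsTubing G T ∧ ∃ t, IsSpecial G t ∧ t ∉ T}

lemma isLowerSet_boundaryTubings : IsLowerSet (boundaryTubings G) := by
  rintro T U hUT ⟨hT, t, ht, htT⟩
  exact ⟨hT.mono hUT, t, ht, fun h' => htT (hUT h')⟩

lemma exists_isUniquelyCompletable_ge [Fintype V] [DecidableEq V] [DecidableRel G.Adj]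
    {T : Set G.Subgraph} (hT : T ∈ boundaryTubings G) :
    ∃ U, IsUniquelyCompletable G U ∧ T ⊆ U := by
  obtain ⟨hT, t, ht, htT⟩ := hT
  obtain ⟨M, hM, hTM⟩ := hT.exists_maximal
  refine ⟨M \ {t}, isUniquelyCompletable_iff.2 ⟨M, hM, t, ht.mem hM, ht, rfl⟩, fun s hs => ?_⟩
  refine ⟨hTM hs, ?_⟩
  rintro rfl
  exact htT hs

lemma IsUniquelyCompletable.ncard_eq [Fintype V] [DecidableEq V] [DecidableRel G.Adj]
    {T : Set G.Subgraph} (hT : IsUniquelyCompletable G T) :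
    T.ncard = Fintype.card V + G.edgeFinset.card - 1 := by
  have := hT.1.2
  omega

lemma IsUniquelyCompletable.mem_boundaryTubings [Fintype V] [DecidableEq V] [DecidableRel G.Adj]
    {T : Set G.Subgraph} (hT : IsUniquelyCompletable G T) : T ∈ boundaryTubings G := by
  obtain ⟨M, hM, t, htM, hsp, rfl⟩ := isUniquelyCompletable_iff.1 hT
  exact ⟨hM.prop.mono Set.sdiff_subset, t, hsp, by simp⟩

lemma maximal_boundaryTubings_iff [Fintype V] [DecidableEq V] [DecidableRel G.Adj]
    {T : Set G.Subgraph} :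
    Maximal (· ∈ boundaryTubings G) T ↔ IsUniquelyCompletable G T := by
  constructor
  · intro h
    obtain ⟨U, hU, hTU⟩ := exists_isUniquelyCompletable_ge h.prop
    rwa [h.eq_of_subset hU.mem_boundaryTubings hTU]
  · intro h
    refine ⟨h.mem_boundaryTubings, fun U hU hTU => ?_⟩
    obtain ⟨W, hW, hUW⟩ := exists_isUniquelyCompletable_ge hU
    have : T = W := Set.eq_of_subset_of_ncard_le (hTU.trans hUW)
      (by rw [h.ncard_eq, hW.ncard_eq]) (Set.toFinite _)
    rw [this]
    exact hUW

end Combinatorics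

/-! ### Triangulations from unique nonnegative combinations -/

section Abstract

variable {ι W : Type*} [Fintype ι] [AddCommGroup W] [Module ℝ W]

lemma mem_convexHull_image_iff {z : ι → W} {A : Set ι} {x : W} :
    x ∈ convexHull ℝ (z '' A) ↔
      ∃ c : ι → ℝ, 0 ≤ c ∧ Function.support c ⊆ A ∧ ∑ i, c i = 1 ∧ ∑ i, c i • z i = x := by
  classical
  constructor
  · intro hx
    refine convexHull_min (t := {x | ∃ c : ι → ℝ, 0 ≤ c ∧ Function.support c ⊆ A ∧
      ∑ i, c i = 1 ∧ ∑ i, c i • z i = x}) ?_ ?_ hx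
    · rintro _ ⟨i, hi, rfl⟩
      refine ⟨Pi.single i 1, ?_, ?_, ?_, ?_⟩
      · exact Pi.single_nonneg.2 zero_le_one
      · intro j hj
        by_contra hjA
        have : j ≠ i := by
          rintro rfl
          exact hjA hi
        simp [this] at hj
      · simp
      · simp [Pi.single_apply]
    · rintro _ ⟨c, hc0, hcA, hc1, rfl⟩ _ ⟨d, hd0, hdA, hd1, rfl⟩ a b ha hb hab
      refine ⟨a • c + b • d, ?_, ?_, ?_, ?_⟩
      · exact add_nonneg (smul_nonneg ha hc0) (smul_nonneg hb hd0)
      · intro i hi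
        by_contra hiA
        have h1 : c i = 0 := by
          by_contra h
          exact hiA (hcA h)
        have h2 : d i = 0 := by
          by_contra h
          exact hiA (hdA h)
        simp [h1, h2] at hi
      · simp [Finset.sum_add_distrib, ← Finset.mul_sum, hc1, hd1, hab]
      · simp [add_smul, mul_smul, Finset.sum_add_distrib, Finset.smul_sum]
  · rintro ⟨c, hc0, hcA, hc1, rfl⟩
    have hzero : ∀ i, i ∉ A → c i = 0 := by
      intro i hi
      by_contra h
      exact hi (hcA h)
    have h1 : ∑ i with i ∈ A, c i = 1 := by
      rw [← hc1]
      refine Finset.sum_subset (Finset.subset_univ _) fun i _ hi => hzero i ?_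
      simpa using hi
    have h2 : ∑ i with i ∈ A, c i • z i = ∑ i, c i • z i := by
      refine Finset.sum_subset (Finset.subset_univ _) fun i _ hi => ?_
      rw [hzero i (by simpa using hi), zero_smul]
    rw [← h2]
    refine (convex_convexHull ℝ _).sum_mem (fun i _ => hc0 i) h1 fun i hi => ?_
    exact subset_convexHull ℝ _ (Set.mem_image_of_mem z (by simpa using hi))

/-- The nonnegative combinations of the vectors `z i` with supports in the family `F` of sets
determine their coefficients. -/
def UniqueReps (z : ι → W) (F : Set (Set ι)) : Prop :=
  ∀ c d : ι → ℝ, 0 ≤ c → 0 ≤ d → Function.support c ∈ F → Function.support d ∈ F →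
    ∑ i, c i • z i = ∑ i, d i • z i → c = d

/-- A linear relation among the vectors of one member of `F` is split into its positive and
negative parts, both of which have their supports in `F`. -/
lemma UniqueReps.linearIndepOn {z : ι → W} {F : Set (Set ι)} (hu : UniqueReps z F)
    (hdown : IsLowerSet F) {A : Set ι} (hA : A ∈ F) : LinearIndepOn ℝ z A := by
  classical
  rw [linearIndepOn_iff']
  intro s g hs hsum i hi
  set k : ι → ℝ := fun i => if i ∈ s then g i else 0 with hk
  have hkA : ∀ i, k i ≠ 0 → i ∈ A := by
    intro i hi
    by_contra hiA
    exact hi (if_neg fun h => hiA (hs h))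
  have hksum : ∑ i, k i • z i = 0 := by
    rw [← hsum]
    simp [hk, ite_smul]
  have h := hu (fun i => max (k i) 0) (fun i => max (-k i) 0) (fun i => le_max_right _ _)
    (fun i => le_max_right _ _)
    (hdown (fun i hi => hkA i fun h => hi (by simp [h])) hA)
    (hdown (fun i hi => hkA i fun h => hi (by simp [h])) hA)
    (by
      rw [← sub_eq_zero, ← Finset.sum_sub_distrib, ← hksum]
      refine Finset.sum_congr rfl fun i _ => ?_
      rw [← sub_smul]
      congr 1
      rcases le_total (k i) 0 with h | h
      · rw [max_eq_right h, max_eq_left (by linarith)]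
        ring
      · rw [max_eq_left h, max_eq_right (by linarith)]
        ring)
  have hi' := congrFun h i
  have hki : k i = g i := if_pos hi
  rw [← hki]
  rcases le_total (k i) 0 with h | h
  · simp only [max_eq_right h, max_eq_left (show 0 ≤ -k i by linarith)] at hi'
    linarith
  · simp only [max_eq_left h, max_eq_right (show -k i ≤ 0 by linarith)] at hi'
    exact hi'

lemma UniqueReps.mem_of_apply_mem_image {z : ι → W} {F : Set (Set ι)} (hu : UniqueReps z F)
    (hdown : IsLowerSet F) {A B : Set ι} (hA : A ∈ F) (hB : B ∈ F) {i : ι} (hi : i ∈ A)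
    (h : z i ∈ z '' B) : i ∈ B := by
  classical
  obtain ⟨j, hj, hij⟩ := h
  have hsupp : ∀ (k : ι) (C : Set ι), C ∈ F → k ∈ C →
      Function.support (Pi.single k (1 : ℝ)) ∈ F := by
    intro k C hC hk
    refine hdown (fun l hl => ?_) hC
    by_contra hlC
    have : l ≠ k := by
      rintro rfl
      exact hlC hk
    simp [this] at hl
  have heq := hu (Pi.single i 1) (Pi.single j 1) (Pi.single_nonneg.2 zero_le_one)
    (Pi.single_nonneg.2 zero_le_one) (hsupp i A hA hi) (hsupp j B hB hj)
    (by simp [Pi.single_apply, hij])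
  have h1 := congrFun heq i
  by_cases hij' : i = j
  · exact hij' ▸ hj
  · simp [hij'] at h1

lemma UniqueReps.subset_of_image_subset {z : ι → W} {F : Set (Set ι)} (hu : UniqueReps z F)
    (hdown : IsLowerSet F) {A B : Set ι} (hA : A ∈ F) (hB : B ∈ F)
    (h : z '' A ⊆ z '' B) : A ⊆ B := fun _ hi =>
  hu.mem_of_apply_mem_image hdown hA hB hi (h (Set.mem_image_of_mem z hi))

lemma UniqueReps.image_injOn {z : ι → W} {F : Set (Set ι)} (hu : UniqueReps z F)
    (hdown : IsLowerSet F) : Set.InjOn (fun A => z '' A) F := fun _ hA _ hB h =>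
  (hu.subset_of_image_subset hdown hA hB h.subset).antisymm
    (hu.subset_of_image_subset hdown hB hA h.symm.subset)

/-- If nonnegative combinations with supports in a family of sets closed under subsets have unique
coefficients, then the simplices spanned by the members of the family form a simplicial complex:
a point common to two simplices has one set of barycentric coordinates, whose support lies in both
members. -/
theorem UniqueReps.isTriangulation {z : ι → W} {F : Set (Set ι)} (hu : UniqueReps z F)
    (hdown : IsLowerSet F) {n : ℕ} (hn : 0 < n)
    (hcard : ∀ A, Maximal (· ∈ F) A → A.ncard = n) :
    IsTriangulation n {s | ∃ A, Maximal (· ∈ F) A ∧ s = z '' A}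
      {x | ∃ c : ι → ℝ, 0 ≤ c ∧ Function.support c ∈ F ∧ ∑ i, c i = 1 ∧ ∑ i, c i • z i = x} := by
  classical
  have hinj : ∀ A ∈ F, Set.InjOn z A := fun A hA => (hu.linearIndepOn hdown hA).injOn
  have hmax : ∀ A ∈ F, ∃ B, A ⊆ B ∧ Maximal (· ∈ F) B := fun A hA =>
    (Set.toFinite F).exists_le_maximal hA
  let K : Geometry.SimplicialComplex ℝ W :=
    { faces := {s | s.Nonempty ∧ ∃ A ∈ F, (s : Set W) = z '' A}
      isRelLowerSet_faces := by
        intro s hs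
        refine ⟨hs.1, fun t hts ht => ⟨ht, ?_⟩⟩
        obtain ⟨-, A, hA, hsA⟩ := hs
        refine ⟨A ∩ z ⁻¹' t, hdown Set.inter_subset_left hA, ?_⟩
        rw [Set.image_inter_preimage, ← hsA, Set.inter_eq_right.2]
        exact_mod_cast hts
      indep := by
        rintro s ⟨-, A, hA, hsA⟩
        have h1 : LinearIndepOn ℝ id (s : Set W) := hsA ▸ (hu.linearIndepOn hdown hA).id_image
        exact LinearIndependent.affineIndependent ℝ h1
      inter_subset_convexHull := by
        rintro s t ⟨-, A, hA, hsA⟩ ⟨-, B, hB, htB⟩ x ⟨hxs, hxt⟩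
        rw [hsA, mem_convexHull_image_iff] at hxs
        rw [htB, mem_convexHull_image_iff] at hxt
        obtain ⟨c, hc0, hcA, hc1, hcx⟩ := hxs
        obtain ⟨d, hd0, hdB, hd1, hdx⟩ := hxt
        have hcd : c = d := hu c d hc0 hd0 (hdown hcA hA) (hdown hdB hB) (hcx.trans hdx.symm)
        rw [hsA, htB]
        refine convexHull_mono (Set.image_inter_subset z A B) ?_
        exact mem_convexHull_image_iff.2
          ⟨c, hc0, Set.subset_inter hcA (hcd ▸ hdB), hc1, hcx⟩ }
  have hface : ∀ s : Finset W, s ∈ K.faces ↔ s.Nonempty ∧ ∃ A ∈ F, (s : Set W) = z '' A :=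
    fun s => Iff.rfl
  have hfacet : ∀ s : Finset W, s ∈ K.facets ↔ ∃ A, Maximal (· ∈ F) A ∧ (s : Set W) = z '' A := by
    intro s
    rw [Geometry.SimplicialComplex.mem_facets]
    constructor
    · rintro ⟨⟨hs, A, hA, hsA⟩, hsmax⟩
      obtain ⟨B, hAB, hB⟩ := hmax A hA
      refine ⟨B, hB, ?_⟩
      have hsub : s ⊆ (Set.toFinite (z '' B)).toFinset := by
        rw [← Finset.coe_subset, Set.Finite.coe_toFinset, hsA]
        exact Set.image_mono hAB
      have h := hsmax _ ((hface _).2 ⟨hs.mono hsub, B, hB.prop, by simp⟩) hsub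
      rw [h]
      simp
    · rintro ⟨A, hA, hsA⟩
      have hne : A.Nonempty := by
        rw [← Set.ncard_pos, hcard A hA]
        exact hn
      refine ⟨⟨?_, A, hA.prop, hsA⟩, ?_⟩
      · rw [← Finset.coe_nonempty, hsA]
        exact hne.image z
      · rintro t ⟨-, B, hB, htB⟩ hst
        rw [← Finset.coe_subset, hsA, htB] at hst
        have hAB := hA.eq_of_subset hB (hu.subset_of_image_subset hdown hA.prop hB hst)
        rw [← Finset.coe_inj, hsA, htB, hAB]
  refine ⟨K, ?_, ?_, ?_⟩
  · ext S
    constructor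
    · rintro ⟨s, hs, rfl⟩
      exact (hfacet s).1 hs
    · rintro ⟨A, hA, rfl⟩
      exact ⟨(Set.toFinite (z '' A)).toFinset, (hfacet _).2 ⟨A, hA, by simp⟩, by simp⟩
  · intro s hs
    obtain ⟨A, hA, hsA⟩ := (hfacet s).1 hs
    rw [← Set.ncard_coe_finset, hsA, (hinj A hA.prop).ncard_image, hcard A hA]
  · ext x
    rw [Geometry.SimplicialComplex.mem_space_iff]
    constructor
    · rintro ⟨s, ⟨-, A, hA, hsA⟩, hx⟩
      rw [hsA, mem_convexHull_image_iff] at hx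
      obtain ⟨c, hc0, hcA, hc⟩ := hx
      exact ⟨c, hc0, hdown hcA hA, hc⟩
    · rintro ⟨c, hc0, hcF, hc1, hcx⟩
      have hx : x ∈ convexHull ℝ (z '' Function.support c) :=
        mem_convexHull_image_iff.2 ⟨c, hc0, le_rfl, hc1, hcx⟩
      refine ⟨(Set.toFinite (z '' Function.support c)).toFinset,
        (hface _).2 ⟨?_, _, hcF, by simp⟩, by simpa using hx⟩
      rw [← Finset.coe_nonempty, Set.Finite.coe_toFinset]
      exact convexHull_nonempty_iff.1 ⟨x, hx⟩

end Abstract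

/-! ### Decomposition of filtrations into tubes -/

section Filtration

variable {V : Type*} {G : SimpleGraph V}

/-- The vertices and edges of a subgraph, as a set of coordinates. -/
def cells (t : G.Subgraph) : Set (V ⊕ G.edgeSet) :=
  {i | Sum.elim (fun v => v ∈ t.verts) (fun e => (e : Sym2 V) ∈ t.edgeSet) i}

@[simp] lemma inl_mem_cells {t : G.Subgraph} {v : V} : Sum.inl v ∈ cells t ↔ v ∈ t.verts := Iff.rfl

@[simp] lemma inr_mem_cells {t : G.Subgraph} {e : G.edgeSet} :
    Sum.inr e ∈ cells t ↔ (e : Sym2 V) ∈ t.edgeSet := Iff.rfl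

lemma le_iff_cells_subset {t s : G.Subgraph} : t ≤ s ↔ cells t ⊆ cells s := by
  constructor
  · rintro h (v | e) hi
    · exact h.1 hi
    · exact edgeSet_subset_of_le h hi
  · intro h
    exact ⟨fun v hv => h (show Sum.inl v ∈ cells t from hv), fun a b hab =>
      h (show Sum.inr ⟨s(a, b), hab.adj_sub⟩ ∈ cells t from hab)⟩

/-- A function on the vertices and edges whose superlevel sets at positive levels are
subgraphs. -/
def IsFiltration (f : V ⊕ G.edgeSet → ℝ) : Prop :=
  0 ≤ f ∧ ∀ (e : G.edgeSet) (v : V), v ∈ (e : Sym2 V) → f (Sum.inr e) ≤ f (Sum.inl v)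

/-- The subgraph on which a filtration is positive. -/
def IsFiltration.supportSubgraph {f : V ⊕ G.edgeSet → ℝ} (hf : IsFiltration f) : G.Subgraph where
  verts := {v | 0 < f (Sum.inl v)}
  Adj a b := ∃ h : G.Adj a b, 0 < f (Sum.inr ⟨s(a, b), h⟩)
  adj_sub h := h.1
  edge_vert := by
    rintro a b ⟨h, hpos⟩
    exact hpos.trans_le (hf.2 ⟨s(a, b), h⟩ a (Sym2.mem_mk_left a b))
  symm := by
    refine ⟨fun a b hab => ?_⟩
    obtain ⟨h, hpos⟩ := hab
    refine ⟨h.symm, ?_⟩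
    have : (⟨s(b, a), h.symm⟩ : G.edgeSet) = ⟨s(a, b), h⟩ := Subtype.ext Sym2.eq_swap
    rw [this]
    exact hpos

lemma IsFiltration.mem_cells_supportSubgraph {f : V ⊕ G.edgeSet → ℝ} (hf : IsFiltration f)
    {i : V ⊕ G.edgeSet} : i ∈ cells hf.supportSubgraph ↔ 0 < f i := by
  rcases i with v | ⟨e, he⟩
  · exact Iff.rfl
  · induction e with
    | h a b => exact ⟨fun h => h.2, fun h => ⟨he, h⟩⟩

lemma isFiltration_sub {f : V ⊕ G.edgeSet → ℝ} (hf : IsFiltration f) {C : G.Subgraph} {m : ℝ}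
    (hle : ∀ i ∈ cells C, m ≤ f i)
    (hcomp : ∀ s : G.Subgraph, s.Connected → s ≤ hf.supportSubgraph →
      s ≤ C ∨ Disjoint s.verts C.verts) :
    IsFiltration (f - m • (cells C).indicator 1) := by
  have hnonneg : 0 ≤ f - m • (cells C).indicator 1 := by
    intro i
    by_cases h : i ∈ cells C
    · simpa [h] using hle i h
    · simpa [h] using hf.1 i
  refine ⟨hnonneg, fun e v hv => ?_⟩
  by_cases he : (e : Sym2 V) ∈ C.edgeSet
  · simpa [he, mem_verts_of_mem_edgeSet he hv] using hf.2 e v hv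
  · by_cases hvC : v ∈ C.verts
    · -- an edge of the support meeting the component `C` would lie in `C`
      have h0 : f (Sum.inr e) = 0 := by
        refine le_antisymm (not_lt.1 fun hpos => he ?_) (hf.1 _)
        obtain ⟨w, hw⟩ := Sym2.mem_iff_exists.1 hv
        have hadj : hf.supportSubgraph.Adj v w := by
          have : (e : Sym2 V) ∈ hf.supportSubgraph.edgeSet :=
            inr_mem_cells.1 (hf.mem_cells_supportSubgraph.2 hpos)
          rwa [hw] at this
        rcases hcomp _ (SimpleGraph.Subgraph.subgraphOfAdj_connected hadj.adj_sub)
          (SimpleGraph.subgraphOfAdj_le_of_adj _ hadj) with h | h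
        · rw [hw]
          exact h.2 (SimpleGraph.subgraphOfAdj_adj_self _)
        · exact absurd hvC (Set.disjoint_left.1 h (by simp))
      have := hnonneg (Sum.inl v)
      simpa [he, h0] using this
    · simpa [he, hvC] using hf.2 e v hv

variable [Fintype G.Subgraph]

/-- The combination of the indicator functions of the subgraphs with coefficients `c`. -/
noncomputable def combination (c : G.Subgraph → ℝ) : V ⊕ G.edgeSet → ℝ :=
  ∑ t, c t • (cells t).indicator 1

lemma combination_apply (c : G.Subgraph → ℝ) (i : V ⊕ G.edgeSet) :
    combination c i = ∑ t, (cells t).indicator (fun _ => c t) i := by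
  simp only [combination, Finset.sum_apply, Pi.smul_apply, smul_eq_mul]
  refine Finset.sum_congr rfl fun t _ => ?_
  by_cases h : i ∈ cells t <;> simp [h]

lemma combination_add (c d : G.Subgraph → ℝ) :
    combination (c + d) = combination c + combination d := by
  simp [combination, add_smul, Finset.sum_add_distrib]

lemma combination_sub (c d : G.Subgraph → ℝ) :
    combination (c - d) = combination c - combination d := by
  simp [combination, sub_smul, Finset.sum_sub_distrib]

lemma combination_single [DecidableEq G.Subgraph] (u : G.Subgraph) (m : ℝ) :
    combination (Pi.single u m) = m • (cells u).indicator 1 := by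
  simp [combination, Pi.single_apply]

lemma combination_eq_zero_iff {c : G.Subgraph → ℝ} (hc : 0 ≤ c) (i : V ⊕ G.edgeSet) :
    combination c i = 0 ↔ ∀ t, i ∈ cells t → c t = 0 := by
  rw [combination_apply, Finset.sum_eq_zero_iff_of_nonneg
    fun t _ => Set.indicator_nonneg (fun _ _ => hc t) i]
  simp [Set.indicator_apply_eq_zero]

lemma combination_nonneg {c : G.Subgraph → ℝ} (hc : 0 ≤ c) (i : V ⊕ G.edgeSet) :
    0 ≤ combination c i := by
  rw [combination_apply]
  exact Finset.sum_nonneg fun t _ => Set.indicator_nonneg (fun _ _ => hc t) i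

lemma combination_pos_iff {c : G.Subgraph → ℝ} (hc : 0 ≤ c) (i : V ⊕ G.edgeSet) :
    0 < combination c i ↔ ∃ t ∈ Function.support c, i ∈ cells t := by
  rw [(combination_nonneg hc i).lt_iff_ne', Ne, combination_eq_zero_iff hc]
  simp only [Function.mem_support]
  push Not
  exact exists_congr fun t => and_comm

lemma isFiltration_combination {c : G.Subgraph → ℝ} (hc : 0 ≤ c) :
    IsFiltration (combination c) := by
  refine ⟨combination_nonneg hc, fun e v hv => ?_⟩
  rw [combination_apply, combination_apply]
  refine Finset.sum_le_sum fun t _ => ?_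
  by_cases h : (e : Sym2 V) ∈ t.edgeSet
  · rw [Set.indicator_of_mem (inr_mem_cells.2 h),
      Set.indicator_of_mem (inl_mem_cells.2 (mem_verts_of_mem_edgeSet h hv))]
  · rw [Set.indicator_of_notMem (fun h' => h (inr_mem_cells.1 h'))]
    exact Set.indicator_nonneg (fun _ _ => hc t) _

variable [Finite V]

/-- Every filtration is a nonnegative combination of the indicator functions of the tubes of a
tubing. The tubes are found by subtracting from the filtration as much as possible of the
indicator function of a component of its support. -/
theorem exists_combination {f : V ⊕ G.edgeSet → ℝ} (hf : IsFiltration f) :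
    ∃ c : G.Subgraph → ℝ, 0 ≤ c ∧ IsTubing G (Function.support c) ∧ combination c = f := by
  classical
  induction h : (Function.support f).ncard using Nat.strong_induction_on generalizing f with
  | _ n ih =>
  by_cases hzero : hf.supportSubgraph.verts = ∅
  · refine ⟨0, le_rfl, ?_, ?_⟩
    · simp [IsTubing]
    · have hv : ∀ v, f (Sum.inl v) ≤ 0 := by
        intro v
        by_contra hpos
        have : v ∈ hf.supportSubgraph.verts := not_le.1 hpos
        simp [hzero] at this
      have hf0 : f = 0 := by
        ext i
        refine le_antisymm ?_ (hf.1 i)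
        rcases i with v | ⟨e, he⟩
        · exact hv v
        · induction e with
          | h a b => exact (hf.2 _ a (Sym2.mem_mk_left a b)).trans (hv a)
      rw [hf0]
      simp [combination]
  · obtain ⟨v, hv⟩ := Set.nonempty_iff_ne_empty.2 hzero
    obtain ⟨C, hC, hvC, hCS, hcomp⟩ := exists_component
      (SimpleGraph.Subgraph.singletonSubgraph_connected (G := G) (v := v))
      ((SimpleGraph.singletonSubgraph_le_iff v hf.supportSubgraph).2 hv)
    have hne : (cells C).Nonempty :=
      ⟨Sum.inl v, (SimpleGraph.singletonSubgraph_le_iff v C).1 hvC⟩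
    obtain ⟨i₀, hi₀, hmin⟩ := Set.exists_min_image (cells C) f (Set.toFinite _) hne
    have hm : 0 < f i₀ :=
      hf.mem_cells_supportSubgraph.1 (le_iff_cells_subset.1 hCS hi₀)
    have hf' := isFiltration_sub hf hmin hcomp
    set f' := f - f i₀ • (cells C).indicator 1 with hf'def
    have hle : ∀ i, f' i ≤ f i := by
      intro i
      by_cases hi : i ∈ cells C <;> simp [hf'def, hi, hm.le]
    have hlt : (Function.support f').ncard < n := by
      rw [← h]
      refine Set.ncard_lt_ncard ⟨?_, ?_⟩ (Set.toFinite _)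
      · intro i hi
        exact ((lt_of_le_of_ne (hf'.1 i) (Ne.symm hi)).trans_le (hle i)).ne'
      · intro hsub
        have := hsub (show i₀ ∈ Function.support f from hm.ne')
        simp [hf'def, hi₀] at this
    obtain ⟨c, hc0, hcT, hcf⟩ := ih _ hlt hf' rfl
    refine ⟨c + Pi.single C (f i₀), add_nonneg hc0 (Pi.single_nonneg.2 hm.le), ?_, ?_⟩
    · refine (hcT.insert hC fun s hs => ?_).mono (U := Function.support (c + Pi.single C (f i₀))) ?_
      · have hsS : s ≤ hf.supportSubgraph := by
          refine le_iff_cells_subset.2 fun i hi => hf.mem_cells_supportSubgraph.2 ?_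
          refine lt_of_lt_of_le ?_ (hle i)
          rw [← hcf]
          exact (combination_pos_iff hc0 i).2 ⟨s, hs, hi⟩
        rcases hcomp s (hcT.connected hs) hsS with h | h
        · exact Or.inr (Or.inr h)
        · exact Or.inl h.symm
      · intro s hs
        by_cases hsC : s = C
        · exact Or.inl hsC
        · right
          simpa [hsC] using hs
    · rw [combination_add, combination_single, hcf, hf'def, sub_add_cancel]

lemma exists_ge_of_combination_eq {c d : G.Subgraph → ℝ} (hc : 0 ≤ c) (hd : 0 ≤ d)
    (hcT : IsTubing G (Function.support c)) (hdT : IsTubing G (Function.support d))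
    (h : combination c = combination d) {t : G.Subgraph} (ht : t ∈ Function.support c) :
    ∃ u ∈ Function.support d, t ≤ u := by
  have hcover : ∀ i ∈ cells t, ∃ s ∈ Function.support d, i ∈ cells s := by
    intro i hi
    rw [← combination_pos_iff hd, ← h, combination_pos_iff hc]
    exact ⟨t, ht, hi⟩
  refine hdT.exists_ge_of_cover (hcT.connected ht) (fun x hx => ?_) (fun a b hab => ?_)
  · exact hcover (Sum.inl x) hx
  · exact hcover (Sum.inr ⟨s(a, b), hab.adj_sub⟩) hab

/-- The coefficients in `exists_combination` are unique: a largest tube among those with a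
nonzero coefficient on one side has to occur on the other side as well, so that the smaller one
of its coefficients can be subtracted on both sides. -/
theorem combination_injective {c d : G.Subgraph → ℝ} (hc : 0 ≤ c) (hd : 0 ≤ d)
    (hcT : IsTubing G (Function.support c)) (hdT : IsTubing G (Function.support d))
    (h : combination c = combination d) : c = d := by
  classical
  induction hn : (Function.support c).ncard + (Function.support d).ncard
    using Nat.strong_induction_on generalizing c d with
  | _ n ih =>
  by_cases hempty : Function.support c ∪ Function.support d = ∅
  · rw [Set.union_empty_iff, Function.support_eq_empty_iff, Function.support_eq_empty_iff] at hempty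
    rw [hempty.1, hempty.2]
  · obtain ⟨t₀, ht₀⟩ := Set.nonempty_iff_ne_empty.2 hempty
    obtain ⟨u, -, hu⟩ := (Set.toFinite (Function.support c ∪ Function.support d)).exists_le_maximal
      ht₀
    have huc : u ∈ Function.support c ∧ u ∈ Function.support d := by
      rcases hu.prop with huc | hud
      · obtain ⟨w, hw, huw⟩ := exists_ge_of_combination_eq hc hd hcT hdT h huc
        exact ⟨huc, (huw.antisymm (hu.le_of_ge (Or.inr hw) huw)) ▸ hw⟩
      · obtain ⟨w, hw, huw⟩ := exists_ge_of_combination_eq hd hc hdT hcT h.symm hud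
        exact ⟨(huw.antisymm (hu.le_of_ge (Or.inl hw) huw)) ▸ hw, hud⟩
    set m := min (c u) (d u) with hm
    have key : ∀ a : G.Subgraph → ℝ, 0 ≤ a → u ∈ Function.support a → m ≤ a u →
        0 ≤ a - Pi.single u m ∧
        Function.support (a - Pi.single u m) ⊆ Function.support a ∧
        (a u = m → Function.support (a - Pi.single u m) ⊂ Function.support a) := by
      intro a ha hua hma
      have hsub : Function.support (a - Pi.single u m) ⊆ Function.support a := by
        intro s hs
        by_cases hsu : s = u
        · exact hsu ▸ hua
        · simpa [hsu] using hs
      refine ⟨fun s => ?_, hsub, fun heq => ⟨hsub, fun hsup => ?_⟩⟩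
      · by_cases hsu : s = u
        · subst hsu
          simpa using hma
        · simpa [hsu] using ha s
      · have := hsup hua
        simp [heq] at this
    obtain ⟨hc0, hcs, hcl⟩ := key c hc huc.1 (min_le_left _ _)
    obtain ⟨hd0, hds, hdl⟩ := key d hd huc.2 (min_le_right _ _)
    have hlt : (Function.support (c - Pi.single u m)).ncard +
        (Function.support (d - Pi.single u m)).ncard < n := by
      rw [← hn]
      have h1 := Set.ncard_le_ncard hcs (Set.toFinite _)
      have h2 := Set.ncard_le_ncard hds (Set.toFinite _)
      rcases min_choice (c u) (d u) with hcase | hcase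
      · have := Set.ncard_lt_ncard (hcl (by rw [hm, hcase])) (Set.toFinite _)
        omega
      · have := Set.ncard_lt_ncard (hdl (by rw [hm, hcase])) (Set.toFinite _)
        omega
    have := ih _ hlt hc0 hd0 (hcT.mono hcs) (hdT.mono hds)
      (by rw [combination_sub, combination_sub, h]) rfl
    exact sub_left_injective this

/-! ### Filtrations of boundary type -/

/-- A combination of the tubes of a tubing is tight, i.e. vanishes on some edge or agrees on some
edge with its value at an endpoint, precisely if the tubing misses a component or a singleton. -/
theorem combination_tight_iff (hG : ∀ v : V, ∃ w : V, G.Adj v w) {c : G.Subgraph → ℝ}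
    (hc : 0 ≤ c) (hT : IsTubing G (Function.support c)) :
    (∃ e : G.edgeSet, combination c (Sum.inr e) = 0 ∨
      ∃ v ∈ (e : Sym2 V), combination c (Sum.inr e) = combination c (Sum.inl v)) ↔
    Function.support c ∈ boundaryTubings G := by
  have hdiff : ∀ (e : G.edgeSet) (v : V), v ∈ (e : Sym2 V) →
      (combination c (Sum.inr e) = combination c (Sum.inl v) ↔
        ∀ t ∈ Function.support c, v ∈ t.verts → (e : Sym2 V) ∈ t.edgeSet) := by
    intro e v hv
    have hle : ∀ t : G.Subgraph, (cells t).indicator (fun _ => c t) (Sum.inr e) ≤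
        (cells t).indicator (fun _ => c t) (Sum.inl v) := by
      intro t
      by_cases h : (e : Sym2 V) ∈ t.edgeSet
      · rw [Set.indicator_of_mem (inr_mem_cells.2 h),
          Set.indicator_of_mem (inl_mem_cells.2 (mem_verts_of_mem_edgeSet h hv))]
      · rw [Set.indicator_of_notMem (fun h' => h (inr_mem_cells.1 h'))]
        exact Set.indicator_nonneg (fun _ _ => hc t) _
    rw [combination_apply, combination_apply, Finset.sum_eq_sum_iff_of_le fun t _ => hle t]
    refine forall_congr' fun t => ?_
    simp only [Finset.mem_univ, forall_true_left, Function.mem_support]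
    by_cases h1 : (e : Sym2 V) ∈ t.edgeSet
    · simp [h1, mem_verts_of_mem_edgeSet h1 hv]
    · by_cases h2 : v ∈ t.verts
      · simp [h1, h2, eq_comm]
      · simp [h1, h2]
  constructor
  · rintro ⟨⟨e, he⟩, h0 | ⟨v, hv, hev⟩⟩
    · induction e with
      | h a b =>
      obtain ⟨C, hC, hle⟩ := exists_maximal_tube_ge
        (SimpleGraph.Subgraph.subgraphOfAdj_connected (G := G) (v := a) (w := b) he)
      refine ⟨hT, C, Or.inr hC, fun hCs => hCs ?_⟩
      exact (combination_eq_zero_iff hc _).1 h0 C (hle.2 (SimpleGraph.subgraphOfAdj_adj_self _))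
    · refine ⟨hT, G.singletonSubgraph v, Or.inl ⟨v, rfl⟩, fun hvs => ?_⟩
      have := (hdiff ⟨e, he⟩ v hv).1 hev _ hvs (by simp)
      simp at this
  · rintro ⟨-, u, hu | hu, hmem⟩
    · obtain ⟨v, rfl⟩ := hu
      -- an edge at `v` lying in all tubes through `v` is found in the smallest such tube
      by_cases hno : ∃ t ∈ Function.support c, v ∈ t.verts
      · obtain ⟨t, ht, hvt⟩ := hno
        obtain ⟨p, -, hp⟩ := (Set.toFinite
          {t | t ∈ Function.support c ∧ v ∈ t.verts}).exists_le_minimal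
          (⟨ht, hvt⟩ : t ∈ {t | t ∈ Function.support c ∧ v ∈ t.verts})
        have hps : ¬ IsSingleton G p := by
          rintro ⟨w, rfl⟩
          have hvw : v = w := hp.prop.2
          exact hmem (hvw ▸ hp.prop.1)
        obtain ⟨w, hw⟩ := exists_adj_of_not_isSingleton (hT.connected hp.prop.1) hps hp.prop.2
        refine ⟨⟨s(v, w), hw.adj_sub⟩, Or.inr ⟨v, Sym2.mem_mk_left v w, ?_⟩⟩
        refine (hdiff _ v (Sym2.mem_mk_left v w)).2 fun s hs hvs => ?_
        rcases hT.le_total_of_mem hp.prop.1 hs hp.prop.2 hvs with h | h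
        · exact h.2 hw
        · exact (hp.le_of_le ⟨hs, hvs⟩ h).2 hw
      · obtain ⟨w, hw⟩ := hG v
        refine ⟨⟨s(v, w), hw⟩, Or.inr ⟨v, Sym2.mem_mk_left v w, ?_⟩⟩
        exact (hdiff _ v (Sym2.mem_mk_left v w)).2 fun s hs hvs => absurd ⟨s, hs, hvs⟩ hno
    · by_contra! hall
      obtain ⟨w, hw, hle⟩ := hT.exists_ge_of_cover_edges hu.prop (not_isSingleton_of_maximal hG hu)
        (fun a b hab => by
          have h1 := (hall ⟨s(a, b), hab.adj_sub⟩).1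
          have h2 := (combination_pos_iff hc _).1 ((combination_nonneg hc _).lt_of_ne' h1)
          exact h2)
      exact hmem ((hle.antisymm (hu.le_of_ge (hT.connected hw) hle)) ▸ hw)

end Filtration

/-! ### Normalization of the vectors of tubes -/

section Basic

variable {V : Type*} [Fintype V] {G : SimpleGraph V} [DecidableRel G.Adj]

lemma sum_tubeNormal_pos {t : G.Subgraph} (ht : t.Connected) : 0 < ∑ i, tubeNormal G t i := by
  classical
  obtain ⟨v, hv⟩ := ht.nonempty
  refine Finset.sum_pos' (fun i _ => ?_) ⟨Sum.inl v, Finset.mem_univ _, ?_⟩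
  · rcases i with v | e
    · simp only [tubeNormal, Sum.elim_inl]
      split_ifs <;> simp
    · simp only [tubeNormal, Sum.elim_inr]
      split_ifs <;> simp
  · simp [tubeNormal, hv]

lemma sum_tubePoint {t : G.Subgraph} (ht : t.Connected) : ∑ i, tubePoint G t i = 1 := by
  simp only [tubePoint, Pi.smul_apply, smul_eq_mul, ← Finset.mul_sum]
  exact inv_mul_cancel₀ (sum_tubeNormal_pos ht).ne'

lemma support_mul_inv {c : G.Subgraph → ℝ} (hT : IsTubing G (Function.support c)) :
    Function.support (fun t => c t * (∑ i, tubeNormal G t i)⁻¹) = Function.support c := by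
  ext t
  simp only [Function.mem_support, ne_eq, mul_eq_zero, inv_eq_zero, not_or, and_iff_left_iff_imp]
  exact fun h => (sum_tubeNormal_pos (hT.connected h)).ne'

lemma mul_inv_nonneg {c : G.Subgraph → ℝ} (hc : 0 ≤ c) (hT : IsTubing G (Function.support c)) :
    0 ≤ fun t => c t * (∑ i, tubeNormal G t i)⁻¹ := by
  intro t
  by_cases h : c t = 0
  · simp [h]
  · exact mul_nonneg (hc t) (inv_nonneg.2 (sum_tubeNormal_pos (hT.connected h)).le)

end Basic

/-! ### Coordinates in which the dual cone consists of filtrations -/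

section Coordinates

variable {V : Type*} [Fintype V] [DecidableEq V] {G : SimpleGraph V}

variable (G) in
/-- The points whose convex hull is the cosmological polytope. -/
def generators : Set (Space G) :=
  {p | ∃ (v w : V) (h : G.Adj v w),
    p = basisX G v + basisX G w - basisY G ⟨s(v, w), h⟩ ∨
    p = basisX G v - basisX G w + basisY G ⟨s(v, w), h⟩}

variable (G) in
/-- The linear change of coordinates that keeps the vertex coordinates and replaces the coordinate
of the edge `e = {v, w}` by `(x_v + x_w - x_e) / 2`. It takes the vectors `h_t` to the indicator
functions of the tubes. -/
noncomputable def filtrationMap : Space G →ₗ[ℝ] (V ⊕ G.edgeSet → ℝ) where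
  toFun x := Sum.elim (fun v => x (Sum.inl v))
    (fun e => ((∑ v with v ∈ (e : Sym2 V), x (Sum.inl v)) - x (Sum.inr e)) / 2)
  map_add' x y := by
    ext (v | e)
    · rfl
    · simp only [Sum.elim_inr, Pi.add_apply, Finset.sum_add_distrib]
      ring
  map_smul' a x := by
    ext (v | e)
    · rfl
    · simp only [Sum.elim_inr, Pi.smul_apply, smul_eq_mul, ← Finset.mul_sum, RingHom.id_apply]
      ring

@[simp] lemma filtrationMap_inl (x : Space G) (v : V) :
    filtrationMap G x (Sum.inl v) = x (Sum.inl v) := rfl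

lemma filtrationMap_inr (x : Space G) {v w : V} (h : G.Adj v w) :
    filtrationMap G x (Sum.inr ⟨s(v, w), h⟩) =
      (x (Sum.inl v) + x (Sum.inl w) - x (Sum.inr ⟨s(v, w), h⟩)) / 2 := by
  have : ({u | u ∈ s(v, w)} : Finset V) = {v, w} := by
    ext u
    simp
  change ((∑ u with u ∈ s(v, w), x (Sum.inl u)) - x (Sum.inr ⟨s(v, w), h⟩)) / 2 = _
  rw [this, Finset.sum_pair h.ne]

lemma filtrationMap_injective : Function.Injective (filtrationMap G) := by
  intro x y hxy
  have hv : ∀ v, x (Sum.inl v) = y (Sum.inl v) := fun v => congrFun hxy (Sum.inl v)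
  ext (v | ⟨e, he⟩)
  · exact hv v
  · induction e with
    | h v w =>
      have := congrFun hxy (Sum.inr ⟨s(v, w), he⟩)
      rw [filtrationMap_inr x he, filtrationMap_inr y he, hv, hv] at this
      linarith

lemma filtrationMap_tubeNormal (t : G.Subgraph) :
    filtrationMap G (tubeNormal G t) = (cells t).indicator 1 := by
  classical
  ext (v | ⟨e, he⟩)
  · by_cases h : v ∈ t.verts <;> simp [tubeNormal, h]
  · induction e with
    | h v w =>
      have hne : v ≠ w := SimpleGraph.Adj.ne he
      rw [filtrationMap_inr _ he]
      by_cases ht : s(v, w) ∈ t.edgeSet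
      · have hv := mem_verts_of_mem_edgeSet ht (Sym2.mem_mk_left v w)
        have hw := mem_verts_of_mem_edgeSet ht (Sym2.mem_mk_right v w)
        rw [Set.indicator_of_mem (inr_mem_cells.2 ht)]
        simp only [tubeNormal, Sum.elim_inl, Sum.elim_inr, if_pos hv, if_pos hw, if_pos ht,
          Pi.one_apply]
        norm_num
      · have hset : ((s(v, w) : Set V) ∩ t.verts).ncard =
            (if v ∈ t.verts then 1 else 0) + (if w ∈ t.verts then 1 else 0) := by
          have h1 : (s(v, w) : Set V) = {v, w} := by
            ext u
            simp
          rw [h1]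
          by_cases hv : v ∈ t.verts <;> by_cases hw : w ∈ t.verts <;>
            simp [Set.insert_inter_of_mem, Set.insert_inter_of_notMem, Set.singleton_inter_of_mem,
              Set.singleton_inter_of_notMem, hv, hw, Set.ncard_pair hne]
        rw [Set.indicator_of_notMem (fun h => ht (inr_mem_cells.1 h))]
        simp only [tubeNormal, Sum.elim_inl, Sum.elim_inr, if_neg ht, hset]
        push_cast
        ring

lemma finite_generators : (generators G).Finite := by
  refine ((Set.finite_range fun q : V × V × G.edgeSet =>
      basisX G q.1 + basisX G q.2.1 - basisY G q.2.2).union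
    (Set.finite_range fun q : V × V × G.edgeSet =>
      basisX G q.1 - basisX G q.2.1 + basisY G q.2.2)).subset ?_
  rintro g ⟨v, w, h, rfl | rfl⟩
  · exact Or.inl ⟨(v, w, ⟨s(v, w), h⟩), rfl⟩
  · exact Or.inr ⟨(v, w, ⟨s(v, w), h⟩), rfl⟩

variable [DecidableRel G.Adj]

lemma dotProduct_generator_add (x : Space G) {v w : V} (h : G.Adj v w) :
    x ⬝ᵥ (basisX G v + basisX G w - basisY G ⟨s(v, w), h⟩) =
      2 * filtrationMap G x (Sum.inr ⟨s(v, w), h⟩) := by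
  rw [filtrationMap_inr]
  simp only [basisX, basisY, dotProduct_sub, dotProduct_add, dotProduct_single, mul_one]
  ring

lemma dotProduct_generator_sub (x : Space G) {v w : V} (h : G.Adj v w) :
    x ⬝ᵥ (basisX G v - basisX G w + basisY G ⟨s(v, w), h⟩) =
      2 * (filtrationMap G x (Sum.inl v) - filtrationMap G x (Sum.inr ⟨s(v, w), h⟩)) := by
  rw [filtrationMap_inr, filtrationMap_inl]
  simp only [basisX, basisY, dotProduct_sub, dotProduct_add, dotProduct_single, mul_one]
  ring

lemma isFiltration_filtrationMap_iff (hG : ∀ v : V, ∃ w : V, G.Adj v w) (x : Space G) :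
    IsFiltration (filtrationMap G x) ↔ ∀ g ∈ generators G, 0 ≤ x ⬝ᵥ g := by
  constructor
  · rintro hf g ⟨v, w, h, rfl | rfl⟩
    · rw [dotProduct_generator_add]
      have := hf.1 (Sum.inr ⟨s(v, w), h⟩)
      simp only [Pi.zero_apply] at this
      linarith
    · rw [dotProduct_generator_sub]
      have := hf.2 ⟨s(v, w), h⟩ v (Sym2.mem_mk_left v w)
      linarith
  · intro hx
    have he : ∀ e : G.edgeSet, 0 ≤ filtrationMap G x (Sum.inr e) := by
      rintro ⟨e, he⟩
      induction e with
      | h v w =>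
        have := hx _ ⟨v, w, he, Or.inl rfl⟩
        rw [dotProduct_generator_add x he] at this
        linarith
    have hev : ∀ (e : G.edgeSet) (v : V), v ∈ (e : Sym2 V) →
        filtrationMap G x (Sum.inr e) ≤ filtrationMap G x (Sum.inl v) := by
      rintro ⟨e, he⟩ v hv
      obtain ⟨w, rfl⟩ := Sym2.mem_iff_exists.1 hv
      have := hx _ ⟨v, w, he, Or.inr rfl⟩
      rw [dotProduct_generator_sub x he] at this
      linarith
    refine ⟨?_, hev⟩
    rintro (v | e)
    · obtain ⟨w, hw⟩ := hG v
      exact (he ⟨s(v, w), hw⟩).trans (hev ⟨s(v, w), hw⟩ v (Sym2.mem_mk_left v w))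
    · exact he e

lemma exists_dotProduct_eq_zero_iff (x : Space G) :
    (∃ g ∈ generators G, x ⬝ᵥ g = 0) ↔
      ∃ e : G.edgeSet, filtrationMap G x (Sum.inr e) = 0 ∨
        ∃ v ∈ (e : Sym2 V), filtrationMap G x (Sum.inr e) = filtrationMap G x (Sum.inl v) := by
  constructor
  · rintro ⟨g, ⟨v, w, h, rfl | rfl⟩, hg⟩
    · rw [dotProduct_generator_add] at hg
      exact ⟨⟨s(v, w), h⟩, Or.inl (by linarith)⟩
    · rw [dotProduct_generator_sub] at hg
      exact ⟨⟨s(v, w), h⟩, Or.inr ⟨v, Sym2.mem_mk_left v w, by linarith⟩⟩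
  · rintro ⟨⟨e, he⟩, h0 | ⟨v, hv, hev⟩⟩
    · induction e with
      | h v w =>
        refine ⟨_, ⟨v, w, he, Or.inl rfl⟩, ?_⟩
        rw [dotProduct_generator_add x he, h0, mul_zero]
    · obtain ⟨w, rfl⟩ := Sym2.mem_iff_exists.1 hv
      refine ⟨_, ⟨v, w, he, Or.inr rfl⟩, ?_⟩
      rw [dotProduct_generator_sub x he, hev, sub_self, mul_zero]

lemma mem_dualPolytope_iff (x : Space G) :
    x ∈ dualPolytope G ↔ (∀ g ∈ generators G, 0 ≤ x ⬝ᵥ g) ∧ ∑ i, x i = 1 := by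
  refine and_congr_left fun _ => ⟨fun h g hg => ?_, ?_⟩
  · exact h g ⟨1, zero_le_one, g, subset_convexHull ℝ _ hg, (one_smul ℝ g).symm⟩
  · rintro h _ ⟨c, hc, y, hy, rfl⟩
    have hconv : Convex ℝ {y : Space G | 0 ≤ x ⬝ᵥ y} :=
      convex_halfSpace_ge ⟨fun y z => dotProduct_add x y z, fun c y => dotProduct_smul c x y⟩ 0
    have : 0 ≤ x ⬝ᵥ y := convexHull_min (s := generators G) h hconv hy
    rw [dotProduct_smul]
    exact smul_nonneg hc this

/-! ### Points of the dual cone as combinations of the points `z_t` -/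

lemma filtrationMap_sum_tubePoint (c : G.Subgraph → ℝ) :
    filtrationMap G (∑ t, c t • tubePoint G t) =
      combination fun t => c t * (∑ i, tubeNormal G t i)⁻¹ := by
  simp only [map_sum, map_smul, tubePoint, filtrationMap_tubeNormal, smul_smul, combination]

lemma sum_sum_tubePoint {c : G.Subgraph → ℝ} (hT : IsTubing G (Function.support c)) :
    ∑ i, (∑ t, c t • tubePoint G t) i = ∑ t, c t := by
  simp only [Finset.sum_apply, Pi.smul_apply, smul_eq_mul]
  rw [Finset.sum_comm]
  refine Finset.sum_congr rfl fun t _ => ?_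
  rw [← Finset.mul_sum]
  by_cases h : c t = 0
  · simp [h]
  · rw [sum_tubePoint (hT.connected h), mul_one]

lemma uniqueReps_tubePoint : UniqueReps (tubePoint G) {T | IsTubing G T} := by
  intro c d hc hd hcT hdT h
  have h1 := congrArg (filtrationMap G) h
  rw [filtrationMap_sum_tubePoint, filtrationMap_sum_tubePoint] at h1
  have h2 := combination_injective (mul_inv_nonneg hc hcT) (mul_inv_nonneg hd hdT)
    (by rwa [support_mul_inv hcT]) (by rwa [support_mul_inv hdT]) h1
  ext t
  have h3 := congrFun h2 t
  by_cases ht : t.Connected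
  · exact mul_right_cancel₀ (inv_ne_zero (sum_tubeNormal_pos ht).ne') h3
  · have hc0 : c t = 0 := by
      by_contra h
      exact ht (hcT.connected h)
    have hd0 : d t = 0 := by
      by_contra h
      exact ht (hdT.connected h)
    rw [hc0, hd0]

lemma exists_sum_tubePoint_eq (hG : ∀ v : V, ∃ w : V, G.Adj v w) {x : Space G}
    (hx : ∀ g ∈ generators G, 0 ≤ x ⬝ᵥ g) :
    ∃ c : G.Subgraph → ℝ, 0 ≤ c ∧ IsTubing G (Function.support c) ∧
      ∑ t, c t • tubePoint G t = x := by
  obtain ⟨c, hc, hT, hcx⟩ := exists_combination ((isFiltration_filtrationMap_iff hG x).2 hx)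
  have hne : ∀ t, c t ≠ 0 → ∑ i, tubeNormal G t i ≠ 0 := fun t ht =>
    (sum_tubeNormal_pos (hT.connected ht)).ne'
  refine ⟨fun t => c t * ∑ i, tubeNormal G t i, fun t => ?_, hT.mono fun t ht => ?_, ?_⟩
  · by_cases h : c t = 0
    · simp [h]
    · exact mul_nonneg (hc t) (sum_tubeNormal_pos (hT.connected h)).le
  · exact left_ne_zero_of_mul ht
  · refine filtrationMap_injective ?_
    rw [filtrationMap_sum_tubePoint, ← hcx]
    congr 1
    ext t
    by_cases h : c t = 0
    · simp [h]
    · exact mul_inv_cancel_right₀ (hne t h) (c t)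

lemma dotProduct_sum_tubePoint_nonneg (hG : ∀ v : V, ∃ w : V, G.Adj v w) {c : G.Subgraph → ℝ}
    (hc : 0 ≤ c) (hT : IsTubing G (Function.support c)) :
    ∀ g ∈ generators G, 0 ≤ (∑ t, c t • tubePoint G t) ⬝ᵥ g := by
  rw [← isFiltration_filtrationMap_iff hG, filtrationMap_sum_tubePoint]
  exact isFiltration_combination (mul_inv_nonneg hc hT)

lemma sum_tubePoint_tight_iff (hG : ∀ v : V, ∃ w : V, G.Adj v w) {c : G.Subgraph → ℝ}
    (hc : 0 ≤ c) (hT : IsTubing G (Function.support c)) :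
    (∃ g ∈ generators G, (∑ t, c t • tubePoint G t) ⬝ᵥ g = 0) ↔
      Function.support c ∈ boundaryTubings G := by
  rw [exists_dotProduct_eq_zero_iff, filtrationMap_sum_tubePoint,
    combination_tight_iff hG (mul_inv_nonneg hc hT) (by rwa [support_mul_inv hT]),
    support_mul_inv hT]

/-! ### The relative interior and boundary of the dual polytope -/

lemma sum_eq_one_of_mem_affineSpan {x : Space G}
    (hx : x ∈ affineSpan ℝ (dualPolytope G)) : ∑ i, x i = 1 := by
  refine affineSpan_induction (p := fun x : Space G => ∑ i, x i = 1) hx (fun y hy => hy.2) ?_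
  · intro c u v w hu hv hw
    simp only [vsub_eq_sub, vadd_eq_add, Pi.add_apply, Pi.smul_apply, Pi.sub_apply, smul_eq_mul,
      Finset.sum_add_distrib, ← Finset.mul_sum, Finset.sum_sub_distrib, hu, hv, hw]
    ring

/-- The barycenter of the standard simplex satisfies all inequalities strictly. -/
lemma exists_strict_point [Nonempty V] :
    ∃ p ∈ dualPolytope G, ∀ g ∈ generators G, 0 < p ⬝ᵥ g := by
  set N : ℝ := ((Fintype.card (V ⊕ G.edgeSet) : ℕ) : ℝ) with hN
  have hNpos : 0 < N := by
    rw [hN]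
    exact_mod_cast Fintype.card_pos
  have hpos : ∀ g ∈ generators G, 0 < (fun _ => N⁻¹ : Space G) ⬝ᵥ g := by
    rintro g ⟨v, w, h, rfl | rfl⟩ <;>
      simp [basisX, basisY, dotProduct_sub, dotProduct_add, dotProduct_single, hNpos]
  refine ⟨fun _ => N⁻¹, ?_, hpos⟩
  rw [mem_dualPolytope_iff]
  refine ⟨fun g hg => (hpos g hg).le, ?_⟩
  rw [Finset.sum_const, Finset.card_univ, nsmul_eq_mul, ← hN, mul_inv_cancel₀ hNpos.ne']

lemma continuous_dotProduct_right {ι : Type*} [Fintype ι] (g : ι → ℝ) :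
    Continuous fun x : ι → ℝ => x ⬝ᵥ g := by
  unfold dotProduct
  fun_prop

lemma isClosed_dualPolytope : IsClosed (dualPolytope G) := by
  have : dualPolytope G = (⋂ g ∈ generators G, {x | 0 ≤ x ⬝ᵥ g}) ∩ {x | ∑ i, x i = 1} := by
    ext x
    simp [mem_dualPolytope_iff]
  rw [this]
  refine IsClosed.inter ?_ ?_
  · exact isClosed_biInter fun g _ => isClosed_le continuous_const (continuous_dotProduct_right g)
  · exact isClosed_eq (by fun_prop) continuous_const

lemma mem_intrinsicInterior_dualPolytope_iff [Nonempty V] {x : Space G} :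
    x ∈ intrinsicInterior ℝ (dualPolytope G) ↔
      x ∈ dualPolytope G ∧ ∀ g ∈ generators G, 0 < x ⬝ᵥ g := by
  rw [mem_intrinsicInterior]
  constructor
  · rintro ⟨y, hy, rfl⟩
    have hyP : (y : Space G) ∈ dualPolytope G :=
      Set.mem_preimage.1 (interior_subset hy)
    refine ⟨hyP, fun g hg => ?_⟩
    by_contra hle
    obtain ⟨p, hp, hpos⟩ := exists_strict_point (G := G)
    -- prolong the segment from a strict point to `y` beyond `y`
    let φ : ℝ → affineSpan ℝ (dualPolytope G) := fun s =>
      ⟨AffineMap.lineMap (y : Space G) p s,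
        AffineMap.lineMap_mem s y.2 (subset_affineSpan ℝ _ hp)⟩
    have hφ : Continuous φ := by
      refine Continuous.subtype_mk ?_ _
      exact AffineMap.lineMap_continuous
    have hφ0 : φ 0 = y := Subtype.ext (AffineMap.lineMap_apply_zero _ _)
    have hnear : ∀ᶠ s in nhds (0 : ℝ), φ s ∈ interior ((↑) ⁻¹' dualPolytope G) :=
      hφ.continuousAt.eventually_mem (by rw [hφ0]; exact isOpen_interior.mem_nhds hy)
    obtain ⟨s, hs, hs0⟩ := ((hnear.filter_mono nhdsWithin_le_nhds).and
      (self_mem_nhdsWithin : Set.Iio (0 : ℝ) ∈ nhdsWithin 0 (Set.Iio 0))).exists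
    have hsP : φ s ∈ ((↑) ⁻¹' dualPolytope G : Set (affineSpan ℝ (dualPolytope G))) :=
      interior_subset hs
    replace hsP : AffineMap.lineMap (y : Space G) p s ∈ dualPolytope G := hsP
    have h1 := ((mem_dualPolytope_iff _).1 hsP).1 g hg
    have h0 : (y : Space G) ⬝ᵥ g = 0 :=
      le_antisymm (not_lt.1 hle) (((mem_dualPolytope_iff _).1 hyP).1 g hg)
    rw [AffineMap.lineMap_apply_module, add_dotProduct, smul_dotProduct, smul_dotProduct, h0,
      smul_zero, zero_add, smul_eq_mul] at h1
    exact absurd h1 (not_le.2 (mul_neg_of_neg_of_pos hs0 (hpos g hg)))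
  · rintro ⟨hx, hpos⟩
    refine ⟨⟨x, subset_affineSpan ℝ _ hx⟩, ?_, rfl⟩
    refine mem_interior.2 ⟨(↑) ⁻¹' ⋂ g ∈ generators G, {x | 0 < x ⬝ᵥ g}, ?_, ?_, ?_⟩
    · intro y hy
      simp only [Set.mem_preimage, Set.mem_iInter, Set.mem_ofPred_eq] at hy
      exact (mem_dualPolytope_iff _).2
        ⟨fun g hg => (hy g hg).le, sum_eq_one_of_mem_affineSpan y.2⟩
    · refine IsOpen.preimage continuous_subtype_val ?_
      exact finite_generators.isOpen_biInter fun g _ =>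
        isOpen_lt continuous_const (continuous_dotProduct_right g)
    · simpa using hpos

lemma mem_intrinsicFrontier_dualPolytope_iff [Nonempty V] {x : Space G} :
    x ∈ intrinsicFrontier ℝ (dualPolytope G) ↔
      x ∈ dualPolytope G ∧ ∃ g ∈ generators G, x ⬝ᵥ g = 0 := by
  rw [← intrinsicClosure_sdiff_intrinsicInterior, IsClosed.intrinsicClosure
    (isClosed_dualPolytope.preimage continuous_subtype_val), Set.mem_sdiff,
    mem_intrinsicInterior_dualPolytope_iff]
  refine and_congr_right fun hx => ?_
  rw [not_and]
  constructor
  · intro h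
    by_contra! hne
    exact h hx fun g hg => (((mem_dualPolytope_iff x).1 hx).1 g hg).lt_of_ne' (hne g hg)
  · rintro ⟨g, hg, h0⟩ - h
    exact (h g hg).ne' h0

end Coordinates

/-! ### Triangulation of the boundary and of the polytope -/

section Cone

variable {ι : Type*}

/-- The cone over a family of sets: the sets obtained from its members by possibly adding the apex
`none`. -/
def coneFamily (F : Set (Set ι)) : Set (Set (Option ι)) := {A | some ⁻¹' A ∈ F}

lemma isLowerSet_coneFamily {F : Set (Set ι)} (hF : IsLowerSet F) : IsLowerSet (coneFamily F) :=
  fun _ _ hBA hA => hF (Set.preimage_mono hBA) hA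

lemma preimage_some_insert_none (T : Set ι) : some ⁻¹' (insert none (some '' T)) = T := by
  ext t
  simp

lemma maximal_coneFamily_iff {F : Set (Set ι)} {A : Set (Option ι)} :
    Maximal (· ∈ coneFamily F) A ↔ ∃ T, Maximal (· ∈ F) T ∧ A = insert none (some '' T) := by
  have hsub : ∀ (A : Set (Option ι)) (T : Set ι), some ⁻¹' A ⊆ T →
      A ⊆ insert none (some '' T) := by
    rintro A T h (_ | t) ht
    · exact Set.mem_insert _ _
    · exact Or.inr ⟨t, h ht, rfl⟩
  have hmem : ∀ T, T ∈ F → insert none (some '' T) ∈ coneFamily F := by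
    intro T hT
    rw [coneFamily, Set.mem_ofPred_eq, preimage_some_insert_none]
    exact hT
  constructor
  · intro hA
    refine ⟨some ⁻¹' A, ⟨hA.prop, fun T hT hAT => ?_⟩,
      hA.eq_of_subset (hmem _ hA.prop) (hsub A _ le_rfl)⟩
    have h : insert none (some '' T) ⊆ A := hA.le_of_ge (hmem T hT) (hsub A T hAT)
    exact fun t ht => h (Or.inr ⟨t, ht, rfl⟩)
  · rintro ⟨T, hT, rfl⟩
    refine ⟨hmem T hT.prop, fun B hB hTB => hsub B T (hT.le_of_ge hB ?_)⟩
    exact fun t ht => hTB (Or.inr ⟨t, ht, rfl⟩)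

lemma image_insert_none {W : Type*} (p : W) (z : ι → W) (T : Set ι) :
    (fun o : Option ι => o.elim p z) '' insert none (some '' T) = insert p (z '' T) := by
  rw [Set.image_insert_eq, Set.image_image]
  rfl

lemma ncard_insert_none [Finite ι] (T : Set ι) :
    (insert none (some '' T) : Set (Option ι)).ncard = T.ncard + 1 := by
  rw [Set.ncard_insert_of_notMem (by simp) (Set.toFinite _),
    Set.ncard_image_of_injective _ (Option.some_injective ι)]

end Cone

lemma two_le_card {V : Type*} [Fintype V] [Nonempty V] {G : SimpleGraph V} [DecidableRel G.Adj]
    (hG : ∀ v : V, ∃ w : V, G.Adj v w) :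
    2 ≤ Fintype.card V + G.edgeFinset.card := by
  obtain ⟨v⟩ := ‹Nonempty V›
  obtain ⟨w, hw⟩ := hG v
  have : 1 < Fintype.card V := Fintype.one_lt_card_iff.2 ⟨v, w, hw.ne⟩
  omega

section Main

variable {V : Type*} [Fintype V] [DecidableEq V] {G : SimpleGraph V} [DecidableRel G.Adj]

lemma uniqueReps_boundaryTubings : UniqueReps (tubePoint G) (boundaryTubings G) :=
  fun c d hc hd hcT hdT h => uniqueReps_tubePoint c d hc hd hcT.1 hdT.1 h

/-- A strict point `p` can be added to the vertices of the boundary simplices: comparing two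
combinations by an inequality that is tight on the one with less of `p` shows that both contain
the same multiple of `p`. -/
lemma uniqueReps_coneFamily (hG : ∀ v : V, ∃ w : V, G.Adj v w) {p : Space G}
    (hp : ∀ g ∈ generators G, 0 < p ⬝ᵥ g) :
    UniqueReps (fun o : Option G.Subgraph => o.elim p (tubePoint G))
      (coneFamily (boundaryTubings G)) := by
  have key : ∀ c d : Option G.Subgraph → ℝ, 0 ≤ c → 0 ≤ d →
      Function.support c ∈ coneFamily (boundaryTubings G) →
      Function.support d ∈ coneFamily (boundaryTubings G) →
      c none • p + ∑ t, c (some t) • tubePoint G t =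
        d none • p + ∑ t, d (some t) • tubePoint G t → d none ≤ c none := by
    intro c d hc hd hcF hdF h
    have hc' : Function.support (fun t => c (some t)) ∈ boundaryTubings G := hcF
    have hd' : Function.support (fun t => d (some t)) ∈ boundaryTubings G := hdF
    obtain ⟨g, hg, hg0⟩ := (sum_tubePoint_tight_iff hG (c := fun t => c (some t))
      (fun t => hc (some t)) hc'.1).2 hc'
    have hdg := dotProduct_sum_tubePoint_nonneg hG (c := fun t => d (some t))
      (fun t => hd (some t)) hd'.1 g hg
    have h1 := congrArg (fun x => x ⬝ᵥ g) h
    simp only [add_dotProduct, smul_dotProduct, hg0, smul_eq_mul, add_zero] at h1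
    have h2 : d none * p ⬝ᵥ g ≤ c none * p ⬝ᵥ g := by linarith
    exact le_of_mul_le_mul_right h2 (hp g hg)
  intro c d hc hd hcF hdF h
  simp only [Fintype.sum_option, Option.elim_none, Option.elim_some] at h
  have hnone : c none = d none :=
    le_antisymm (key d c hd hc hdF hcF h.symm) (key c d hc hd hcF hdF h)
  rw [hnone] at h
  have hsome := uniqueReps_boundaryTubings (fun t => c (some t)) (fun t => d (some t))
    (fun t => hc (some t)) (fun t => hd (some t)) hcF hdF (add_left_cancel h)
  ext o
  cases o with
  | none => exact hnone
  | some t => exact congrFun hsome t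

variable [Nonempty V]

theorem isTriangulation_frontier (hG : ∀ v : V, ∃ w : V, G.Adj v w) :
    IsTriangulation (Fintype.card V + G.edgeFinset.card - 1)
      {s | ∃ T, IsUniquelyCompletable G T ∧ s = simplexVertices G T}
      (intrinsicFrontier ℝ (dualPolytope G)) := by
  have h := uniqueReps_boundaryTubings.isTriangulation isLowerSet_boundaryTubings
    (n := Fintype.card V + G.edgeFinset.card - 1) (by have := two_le_card hG; omega)
    fun A hA => (maximal_boundaryTubings_iff.1 hA).ncard_eq
  simp only [maximal_boundaryTubings_iff] at h
  convert! h using 1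
  ext x
  rw [mem_intrinsicFrontier_dualPolytope_iff, mem_dualPolytope_iff]
  constructor
  · rintro ⟨⟨hx, hx1⟩, htight⟩
    obtain ⟨c, hc, hT, rfl⟩ := exists_sum_tubePoint_eq hG hx
    exact ⟨c, hc, (sum_tubePoint_tight_iff hG hc hT).1 htight, (sum_sum_tubePoint hT) ▸ hx1, rfl⟩
  · rintro ⟨c, hc, hT, hc1, rfl⟩
    exact ⟨⟨dotProduct_sum_tubePoint_nonneg hG hc hT.1, (sum_sum_tubePoint hT.1).trans hc1⟩,
      (sum_tubePoint_tight_iff hG hc hT.1).2 hT⟩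

/-- A point of the polytope is decomposed by subtracting from it the largest multiple of the apex
`p` for which all inequalities remain valid. Then one of them has become tight. -/
theorem isTriangulation_cone (hG : ∀ v : V, ∃ w : V, G.Adj v w) {p : Space G}
    (hp : p ∈ intrinsicInterior ℝ (dualPolytope G)) :
    IsTriangulation (Fintype.card V + G.edgeFinset.card)
      {s | ∃ T, IsUniquelyCompletable G T ∧ s = insert p (simplexVertices G T)}
      (dualPolytope G) := by
  obtain ⟨hpP, hpos⟩ := mem_intrinsicInterior_dualPolytope_iff.1 hp
  have hp1 : ∑ i, p i = 1 := hpP.2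
  have h2 := two_le_card hG
  have h := (uniqueReps_coneFamily hG hpos).isTriangulation
    (isLowerSet_coneFamily isLowerSet_boundaryTubings)
    (n := Fintype.card V + G.edgeFinset.card) (by omega) (by
      intro A hA
      obtain ⟨T, hT, rfl⟩ := maximal_coneFamily_iff.1 hA
      rw [ncard_insert_none, (maximal_boundaryTubings_iff.1 hT).ncard_eq]
      omega)
  convert! h using 1
  · ext s
    constructor
    · rintro ⟨T, hT, rfl⟩
      exact ⟨_, maximal_coneFamily_iff.2 ⟨T, maximal_boundaryTubings_iff.2 hT, rfl⟩,
        (image_insert_none _ _ _).symm⟩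
    · rintro ⟨A, hA, rfl⟩
      obtain ⟨T, hT, rfl⟩ := maximal_coneFamily_iff.1 hA
      exact ⟨T, maximal_boundaryTubings_iff.1 hT, image_insert_none _ _ _⟩
  · ext x
    rw [mem_dualPolytope_iff]
    simp only [Set.mem_ofPred_eq, Fintype.sum_option, Option.elim_none, Option.elim_some]
    constructor
    · rintro ⟨hx, hx1⟩
      obtain ⟨v⟩ := ‹Nonempty V›
      obtain ⟨w, hw⟩ := hG v
      obtain ⟨g₀, hg₀, hmin⟩ := Set.exists_min_image (generators G)
        (fun g => x ⬝ᵥ g / p ⬝ᵥ g) finite_generators ⟨_, v, w, hw, Or.inl rfl⟩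
      set a := x ⬝ᵥ g₀ / p ⬝ᵥ g₀ with ha
      have ha0 : 0 ≤ a := div_nonneg (hx g₀ hg₀) (hpos g₀ hg₀).le
      have hrest : ∀ g ∈ generators G, 0 ≤ (x - a • p) ⬝ᵥ g := by
        intro g hg
        rw [sub_dotProduct, smul_dotProduct, smul_eq_mul, sub_nonneg]
        exact (le_div_iff₀ (hpos g hg)).1 (hmin g hg)
      have hzero : (x - a • p) ⬝ᵥ g₀ = 0 := by
        rw [sub_dotProduct, smul_dotProduct, smul_eq_mul, ha,
          div_mul_cancel₀ _ (hpos g₀ hg₀).ne', sub_self]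
      obtain ⟨c, hc, hT, hcx⟩ := exists_sum_tubePoint_eq hG hrest
      have hsum := sum_sum_tubePoint hT
      rw [hcx] at hsum
      simp only [Pi.sub_apply, Pi.smul_apply, smul_eq_mul, Finset.sum_sub_distrib,
        ← Finset.mul_sum, hx1, hp1] at hsum
      refine ⟨fun o => o.elim a c, ?_, ?_, ?_, ?_⟩
      · rintro (_ | t)
        · exact ha0
        · exact hc t
      · exact (sum_tubePoint_tight_iff hG hc hT).1 ⟨g₀, hg₀, by rw [hcx, hzero]⟩
      · simp only [Option.elim_none, Option.elim_some]
        linarith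
      · simp only [Option.elim_none, Option.elim_some, hcx]
        abel
    · rintro ⟨c, hc, hcF, hc1, rfl⟩
      have hT : Function.support (fun t => c (some t)) ∈ boundaryTubings G := hcF
      constructor
      · intro g hg
        rw [add_dotProduct, smul_dotProduct, smul_eq_mul]
        exact add_nonneg (mul_nonneg (hc none) (hpos g hg).le)
          (dotProduct_sum_tubePoint_nonneg hG (c := fun t => c (some t))
            (fun t => hc (some t)) hT.1 g hg)
      · have hsum := sum_sum_tubePoint hT.1
        simp only [Pi.add_apply, Pi.smul_apply, smul_eq_mul, Finset.sum_add_distrib,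
          ← Finset.mul_sum, hp1]
        rw [hsum]
        linarith

end Main

end Cosmological

theorem mainTheorem5 {V : Type*} [Fintype V] [DecidableEq V] [Nonempty V]
    (G : SimpleGraph V) [DecidableRel G.Adj] (hG : ∀ v : V, ∃ w : V, G.Adj v w) :
    -- the simplices of the uniquely completable tubings triangulate the boundary
    Cosmological.IsTriangulation (Fintype.card V + G.edgeFinset.card - 1)
      {s | ∃ T, Cosmological.IsUniquelyCompletable G T ∧ s = Cosmological.simplexVertices G T}
      (intrinsicFrontier ℝ (Cosmological.dualPolytope G)) ∧
    -- distinct tubings give distinct simplices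
    Set.InjOn (Cosmological.simplexVertices G) {T | Cosmological.IsUniquelyCompletable G T} ∧
    -- coning from any interior point triangulates the dual polytope
    (∀ p ∈ intrinsicInterior ℝ (Cosmological.dualPolytope G),
      Cosmological.IsTriangulation (Fintype.card V + G.edgeFinset.card)
        {s | ∃ T, Cosmological.IsUniquelyCompletable G T ∧
          s = insert p (Cosmological.simplexVertices G T)}
        (Cosmological.dualPolytope G)) ∧
    -- for connected `G`, the description of uniquely completable tubings by removal of one tube
    (G.Connected → ∀ T : Set G.Subgraph, Cosmological.IsUniquelyCompletable G T ↔
      ∃ M, Cosmological.IsMaximalTubing G M ∧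
        ∃ t ∈ M, (Cosmological.IsSingleton G t ∨ t = ⊤) ∧ T = M \ {t}) := by
  refine ⟨Cosmological.isTriangulation_frontier hG, ?_,
    fun p hp => Cosmological.isTriangulation_cone hG hp, fun hconn T => ?_⟩
  · exact (Cosmological.uniqueReps_boundaryTubings.image_injOn
      Cosmological.isLowerSet_boundaryTubings).mono fun _ hT => hT.mem_boundaryTubings
  · rw [Cosmological.isUniquelyCompletable_iff]
    simp only [Cosmological.IsSpecial, Cosmological.maximal_tube_iff_eq_top hconn]
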